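/- Let $S^1\subset\mathbb{C}$ be the unit circle. For a $C^\infty$ map $h\colon[0,1]\to S^1$ put $\|h\|_{W^{1,1}}=\int_0^1|h(x)|\,dx+\int_0^1|h'(x)|\,dx$. For an integer $n\ge 1$ let $Y_n$ be the space of $C^\infty$ maps $h\colon[0,1]\to S^1$ with $\|h\|_{W^{1,1}}\le 1+\pi n$, with the topology of the $L^1$-metric $d(h,k)=\int_0^1|h(x)-k(x)|\,dx$ and the $\mathbb{Z}/2$-action generated by $h\mapsto -h$. For a space $Z$ with a $\mathbb{Z}/2$-action generated by $\sigma\colon Z\to Z$, let $\operatorname{coind} Z$ denote the largest integer $m$ for which there is a continuous map $f\colon S^m\to Z$ with $f(-x)=\sigma(f(x))$ for all $x\in S^m$. Then $\operatorname{coind} Y_n$ exists (that is, there is a largest such $m$ for $Z=Y_n$), and $$n\le \operatorname{coind} Y_n\le 2n-1 .$$ -/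

import Mathlib

open Set
open scoped ContDiff

noncomputable section

namespace CircleMaps

/-- A `C^∞` map `[0,1] → S¹ ⊆ ℂ` (one-sided derivatives at the endpoints).  Smoothness is that of
the complex-valued function on the subset `[0,1]` of `ℝ`; `IccExtend` only serves to regard
a function on the subtype as a function on `ℝ`. -/
structure SmoothMap where
  toFun : Icc (0 : ℝ) 1 → Circle
  smooth : ContDiffOn ℝ ∞
    (IccExtend (zero_le_one' ℝ) fun t => (toFun t : ℂ)) (Icc (0 : ℝ) 1)

namespace SmoothMap

/-- The map as a complex-valued function of a real variable; only the values on `[0,1]` matter. -/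
def fn (h : SmoothMap) : ℝ → ℂ := IccExtend (zero_le_one' ℝ) fun t => (h.toFun t : ℂ)

theorem fn_coe (h : SmoothMap) (t : Icc (0 : ℝ) 1) : h.fn t = (h.toFun t : ℂ) := by
  simp [fn]

theorem contDiffOn_fn (h : SmoothMap) : ContDiffOn ℝ ∞ h.fn (Icc (0 : ℝ) 1) := h.smooth

@[ext]
theorem ext {h k : SmoothMap} (hk : ∀ t, h.toFun t = k.toFun t) : h = k := by
  cases h; cases k; congr; exact funext hk

/-- The norm `‖h‖_{W^{1,1}} = ∫₀¹ |h| + ∫₀¹ |h'|`. -/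
def w11Norm (h : SmoothMap) : ℝ :=
  (∫ x in (0 : ℝ)..1, ‖h.fn x‖) + ∫ x in (0 : ℝ)..1, ‖derivWithin h.fn (Icc (0 : ℝ) 1) x‖

theorem continuousOn_norm_sub (h k : SmoothMap) :
    ContinuousOn (fun x => ‖h.fn x - k.fn x‖) (Icc (0 : ℝ) 1) :=
  (h.contDiffOn_fn.continuousOn.sub k.contDiffOn_fn.continuousOn).norm

theorem intervalIntegrable_norm_sub (h k : SmoothMap) :
    IntervalIntegrable (fun x => ‖h.fn x - k.fn x‖) MeasureTheory.volume 0 1 :=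
  ContinuousOn.intervalIntegrable (by
    simpa [uIcc_of_le (zero_le_one' ℝ)] using continuousOn_norm_sub h k)

/-- The `L¹`-metric `d(h, k) = ∫₀¹ |h - k|`; it defines the topology. -/
instance : MetricSpace SmoothMap where
  dist h k := ∫ x in (0 : ℝ)..1, ‖h.fn x - k.fn x‖
  dist_self h := by simp
  dist_comm h k := by simp only [norm_sub_rev]
  dist_triangle h k l := by
    rw [← intervalIntegral.integral_add (intervalIntegrable_norm_sub h k)
      (intervalIntegrable_norm_sub k l)]
    exact intervalIntegral.integral_mono_on zero_le_one (intervalIntegrable_norm_sub h l)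
      ((intervalIntegrable_norm_sub h k).add (intervalIntegrable_norm_sub k l))
      fun x _ => norm_sub_le_norm_sub_add_norm_sub _ _ _
  eq_of_dist_eq_zero {h k} hd := by
    by_contra hne
    have hex : ∃ t, h.toFun t ≠ k.toFun t := by
      by_contra! hall
      exact hne (SmoothMap.ext hall)
    obtain ⟨t, ht⟩ := hex
    refine (intervalIntegral.integral_pos zero_lt_one (continuousOn_norm_sub h k)
      (fun x _ => norm_nonneg _) ⟨t, t.2, ?_⟩).ne' hd
    rw [fn_coe, fn_coe, norm_pos_iff, sub_ne_zero]
    exact fun he => ht (Circle.ext he)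

theorem dist_def (h k : SmoothMap) :
    dist h k = ∫ x in (0 : ℝ)..1, ‖h.fn x - k.fn x‖ := rfl

/-- The pointwise negative `h ↦ -h`. -/
instance : Neg SmoothMap where
  neg h := ⟨fun t => -h.toFun t, by
    have e : (IccExtend (zero_le_one' ℝ) fun t => ((-h.toFun t : Circle) : ℂ)) = -h.fn := by
      funext x; simp [fn, IccExtend]
    rw [e]
    exact h.contDiffOn_fn.neg⟩

theorem neg_toFun (h : SmoothMap) (t : Icc (0 : ℝ) 1) : (-h).toFun t = -h.toFun t := rfl

theorem fn_neg (h : SmoothMap) : (-h).fn = -h.fn := by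
  funext x; simp [fn, IccExtend, neg_toFun]

theorem w11Norm_neg (h : SmoothMap) : (-h).w11Norm = h.w11Norm := by
  simp [w11Norm, fn_neg, derivWithin.neg]

end SmoothMap

/-- The space `Y_n` of smooth maps `[0,1] → S¹` with `W^{1,1}`-norm at most `1 + πn`, as a subspace
of the smooth maps with the `L¹`-metric. -/
abbrev Y (n : ℕ) : Type := {h : SmoothMap // h.w11Norm ≤ 1 + Real.pi * n}

/-- The action `h ↦ -h` of `ℤ/2` on `Y_n`. -/
def Y.neg {n : ℕ} (h : Y n) : Y n := ⟨-h.1, by rw [SmoothMap.w11Norm_neg]; exact h.2⟩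

theorem Y.neg_involutive {n : ℕ} : Function.Involutive (Y.neg (n := n)) := fun h =>
  Subtype.ext (SmoothMap.ext fun t => neg_neg (h.1.toFun t))

theorem Y.continuous_neg {n : ℕ} : Continuous (Y.neg (n := n)) := by
  refine Isometry.continuous (Isometry.of_dist_eq fun h k => ?_)
  simp only [Subtype.dist_eq, Y.neg, SmoothMap.dist_def, SmoothMap.fn_neg, Pi.neg_apply,
    neg_sub_neg, norm_sub_rev]

end CircleMaps

/-- The unit sphere `S^m` in `ℝ^{m+1}`; the antipodal map is `x ↦ -x`. -/
abbrev UnitSphere (m : ℕ) : Type := Metric.sphere (0 : EuclideanSpace ℝ (Fin (m + 1))) 1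

/-- `k` is the `ℤ/2`-coindex of the space `Z` with the action generated by `σ`: the largest `m`
such that there is a continuous `f : S^m → Z` with `f (-x) = σ (f x)` for all `x`. -/
def IsCoindex {Z : Type*} [TopologicalSpace Z] (σ : Z → Z) (k : ℕ) : Prop :=
  IsGreatest {m : ℕ | ∃ f : C(UnitSphere m, Z), ∀ x, f (-x) = σ (f x)} k

end

open Set
open scoped ContDiff

noncomputable section

/-! ### Mod 2 chains of ordered affine simplices -/

namespace ListChain

/-! Upper bound. Cut `[0,1]` into `n` equal intervals and send `h` to its `n` integrals over them, a
point of `ℂⁿ = ℝ²ⁿ`. This is odd and `L¹`-continuous, and it has no zero on `Y n`. A circle map of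
variation at most `π` on an interval stays in a closed half-plane and is not always on its edge, so
its integral there is nonzero (`pi_lt_integral_norm_dfn`). If all the integrals vanished, the total
variation would exceed `πn`. Hence Borsuk–Ulam (`exists_zero_of_odd_sphere`) excludes `S^m` for `m ≥
2n`.

Borsuk–Ulam is proved with mod 2 chains. Let an odd `F` from the nonzero vectors to `ℝ^p` have no
zero. The cup product of the coboundaries of the `p` coordinate signs evaluates to 1 on every
subdivision of the `p`-dimensional hemisphere of a cross-polytope (`ev_cup_sd_iterate_hemisphere`).
On a small simplex some coordinate has constant sign, so the product vanishes there, a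
contradiction.

Lower bound. Put `k = ⌊n/2⌋` and map `S^n` oddly to the sphere of complex polynomials of degree at
most `k`. Split a polynomial into `k` linear forms `aX + b`, constants included. Each form gives a
path from the phase of `a` to the phase of `b`, turning clockwise by at most `2π`; the product of
the paths has variation at most `2πk ≤ πn`. When `b/a` crosses the positive reals, the path changes
from constant to a full turn, but this turn is squeezed into a vanishing time, which `L¹` does not
see (`continuousAt_factor`, `continuousAt_prodMap`). The product depends only on the polynomial
(`rootProd_polyOf`), so it descends continuously from factorizations to polynomials. -/

/-- Formal sums mod 2 of ordered simplices, a simplex being the list of its vertices. -/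
abbrev Chain (E : Type*) : Type _ := List E →₀ ZMod 2

variable {E : Type*}

/-- The cone with apex `v`. -/
def cone (v : E) : Chain E →ₗ[ZMod 2] Chain E := Finsupp.lmapDomain _ _ (List.cons v)

/-- The (augmented) boundary of a simplex. -/
def bdryList : List E → Chain E
  | [] => 0
  | v :: l => Finsupp.single l 1 + cone v (bdryList l)

/-- The (augmented) boundary operator. -/
def bdry : Chain E →ₗ[ZMod 2] Chain E := Finsupp.linearCombination _ bdryList

@[simp]
theorem cone_single (v : E) (l : List E) (a : ZMod 2) :
    cone v (Finsupp.single l a) = Finsupp.single (v :: l) a := by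
  simp [cone, Finsupp.lmapDomain_apply, Finsupp.mapDomain_single]

@[simp]
theorem bdry_single (l : List E) : bdry (Finsupp.single l 1) = bdryList l := by
  simp [bdry]

theorem bdry_cone (v : E) (c : Chain E) : bdry (cone v c) = c + cone v (bdry c) := by
  suffices h : bdry ∘ₗ cone v = LinearMap.id + cone v ∘ₗ bdry from LinearMap.congr_fun h c
  ext l : 2
  simp [bdryList]

theorem bdry_bdryList (l : List E) : bdry (bdryList l) = 0 := by
  induction l with
  | nil => simp [bdryList]
  | cons v l ih => simp [bdryList, bdry_cone, ih, ZModModule.add_self]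

/-- Size and position of simplices are tracked as supports, so cancellation mod 2 needs no
attention. -/
theorem linearCombination_mem_supported {s t : Set (List E)} {F : List E → Chain E}
    {c : Chain E} (hc : c ∈ Finsupp.supported (ZMod 2) (ZMod 2) s)
    (hF : ∀ l ∈ s, F l ∈ Finsupp.supported (ZMod 2) (ZMod 2) t) :
    Finsupp.linearCombination (ZMod 2) F c ∈ Finsupp.supported (ZMod 2) (ZMod 2) t := by
  rw [Finsupp.linearCombination_apply]
  exact Submodule.sum_mem _ fun l hl => Submodule.smul_mem _ _ (hF l (hc hl))

theorem cone_mem_supported {s t : Set (List E)} {v : E} {c : Chain E}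
    (hc : c ∈ Finsupp.supported (ZMod 2) (ZMod 2) s) (h : ∀ l ∈ s, v :: l ∈ t) :
    cone v c ∈ Finsupp.supported (ZMod 2) (ZMod 2) t := by
  have : cone v c = Finsupp.linearCombination (ZMod 2)
      (fun l => Finsupp.single (v :: l) (1 : ZMod 2)) c := by
    simp only [cone, Finsupp.lmapDomain_apply, Finsupp.mapDomain,
      Finsupp.linearCombination_apply, Finsupp.smul_single, smul_eq_mul, mul_one]
  rw [this]
  exact linearCombination_mem_supported hc fun l hl =>
    Finsupp.single_mem_supported (ZMod 2) _ (h l hl)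

theorem bdryList_mem_supported (l : List E) :
    bdryList l ∈ Finsupp.supported (ZMod 2) (ZMod 2)
      {l' | l'.length + 1 = l.length ∧ ∀ x ∈ l', x ∈ l} := by
  induction l with
  | nil => simp [bdryList]
  | cons v l ih =>
    refine Submodule.add_mem _ (Finsupp.single_mem_supported _ _ ?_) (cone_mem_supported ih ?_)
    · simp +contextual
    · rintro l' ⟨h1, h2⟩
      simp only [mem_ofPred_eq, List.length_cons, List.mem_cons, h1, true_and]
      rintro x (rfl | hx)
      · exact Or.inl rfl
      · exact Or.inr (h2 x hx)

/-! ### Products of sign cochains -/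

/-- The cup product of the coboundaries of the functions in the list `S`. -/
def cup : List (E → ZMod 2) → List E → ZMod 2
  | [], [_] => 1
  | s :: S, x :: y :: l => (s x + s y) * cup S (y :: l)
  | _, _ => 0

/-- A function on simplices as a functional on chains. -/
abbrev ev (a : List E → ZMod 2) : Chain E →ₗ[ZMod 2] ZMod 2 := Finsupp.linearCombination _ a

/-- The cup product of the function `s` with a cochain. -/
def headMul (s : E → ZMod 2) (a : List E → ZMod 2) : List E → ZMod 2
  | [] => 0
  | x :: l => s x * a (x :: l)

theorem cup_nil_right (S : List (E → ZMod 2)) : cup S [] = 0 := by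
  cases S <;> rfl

theorem ev_headMul_cone (s : E → ZMod 2) (a : List E → ZMod 2) (x : E) (c : Chain E) :
    ev (headMul s a) (cone x c) = s x * ev a (cone x c) := by
  suffices h : ev (headMul s a) ∘ₗ cone x = s x • (ev a ∘ₗ cone x) from LinearMap.congr_fun h c
  ext l : 2
  simp [headMul]

theorem ev_cup_nil_cone_cone (x y : E) (c : Chain E) :
    ev (cup []) (cone x (cone y c)) = 0 := by
  suffices h : ev (cup []) ∘ₗ cone x ∘ₗ cone y = 0 from LinearMap.congr_fun h c
  ext l : 2
  simp [cup]

/-- `cup []` is 1 on single vertices and 0 on all other lists; an edge has two ends, and `1 + 1 =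
0`. -/
theorem ev_cup_nil_bdryList (l : List E) : ev (cup []) (bdryList l) = 0 := by
  match l with
  | [] => simp [bdryList]
  | [x] => simp [bdryList, cup]
  | [x, y] =>
    simp [bdryList, cup]
    decide
  | x :: y :: z :: l => simp [bdryList, cup, ev_cup_nil_cone_cone]

/-- Leibniz rule: since `cup S` is a cocycle, the coboundary of `s ⌣ cup S` is `δs ⌣ cup S`. -/
theorem ev_headMul_bdryList (s : E → ZMod 2) (S : List (E → ZMod 2))
    (hS : ∀ l, ev (cup S) (bdryList l) = 0) (l : List E) :
    ev (headMul s (cup S)) (bdryList l) = cup (s :: S) l := by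
  match l with
  | [] => simp [bdryList, cup]
  | x :: l =>
    have h1 : ev (cup S) (cone x (bdryList l)) = cup S l := by
      have := hS (x :: l)
      rw [bdryList, map_add] at this
      rw [← sub_eq_zero, ← this, ZModModule.sub_eq_add, add_comm]
      simp
    rw [bdryList, map_add, ev_headMul_cone, h1]
    match l with
    | [] => simp [headMul, cup, cup_nil_right]
    | y :: l => simp [headMul, cup]; ring

/-- For nonempty `S` the product is itself a coboundary, by the Leibniz rule, so it kills boundaries
because `∂∂ = 0`. -/
theorem ev_cup_bdryList (S : List (E → ZMod 2)) (l : List E) : ev (cup S) (bdryList l) = 0 := by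
  induction S generalizing l with
  | nil => exact ev_cup_nil_bdryList l
  | cons s S ih =>
    have h : ∀ c, ev (cup (s :: S)) c = ev (headMul s (cup S)) (bdry c) := fun c => by
      suffices h : ev (cup (s :: S)) = ev (headMul s (cup S)) ∘ₗ bdry from LinearMap.congr_fun h c
      ext l : 2
      simp [ev_headMul_bdryList s S ih]
    rw [h, bdry_bdryList, map_zero]

theorem ev_headMul_bdry (s : E → ZMod 2) (S : List (E → ZMod 2)) (c : Chain E) :
    ev (headMul s (cup S)) (bdry c) = ev (cup (s :: S)) c := by
  suffices h : ev (headMul s (cup S)) ∘ₗ bdry = ev (cup (s :: S)) from LinearMap.congr_fun h c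
  ext l : 2
  simp [ev_headMul_bdryList s S (ev_cup_bdryList S)]

/-- Used in contrapositive form: a sign that is constant on the vertices makes the product vanish.
-/
theorem exists_ne_of_cup_ne_zero {S : List (E → ZMod 2)} {l : List E} (h : cup S l ≠ 0) :
    ∀ s ∈ S, ∃ x ∈ l, ∃ y ∈ l, s x ≠ s y := by
  induction S generalizing l with
  | nil => simp
  | cons s S ih =>
    match l with
    | [] => simp [cup] at h
    | [x] => simp [cup] at h
    | x :: y :: l =>
      rw [cup] at h
      intro s' hs'
      rcases List.mem_cons.1 hs' with rfl | hs'
      · refine ⟨x, by simp, y, by simp, fun e => left_ne_zero_of_mul h ?_⟩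
        rw [e, ZModModule.add_self]
      · obtain ⟨a, ha, b, hb, hab⟩ := ih (right_ne_zero_of_mul h) s' hs'
        exact ⟨a, List.mem_cons_of_mem _ ha, b, List.mem_cons_of_mem _ hb, hab⟩

/-! ### The antipodal action and barycentric subdivision -/

section Reflect

variable [AddCommGroup E]

/-- The action of `x ↦ -x` on chains. -/
def reflect : Chain E →ₗ[ZMod 2] Chain E := Finsupp.lmapDomain _ _ (List.map Neg.neg)

@[simp]
theorem reflect_single (l : List E) (a : ZMod 2) :
    reflect (Finsupp.single l a) = Finsupp.single (l.map Neg.neg) a := by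
  simp [reflect, Finsupp.lmapDomain_apply, Finsupp.mapDomain_single]

theorem reflect_cone (v : E) (c : Chain E) : reflect (cone v c) = cone (-v) (reflect c) := by
  suffices h : reflect ∘ₗ cone v = cone (-v) ∘ₗ reflect from LinearMap.congr_fun h c
  ext l : 2
  simp

theorem reflect_reflect (c : Chain E) : reflect (reflect c) = c := by
  suffices h : reflect ∘ₗ reflect = (LinearMap.id : Chain E →ₗ[ZMod 2] Chain E) from
    LinearMap.congr_fun h c
  ext l : 2
  simp

theorem reflect_bdryList (l : List E) :
    reflect (bdryList l) = bdryList (l.map Neg.neg) := by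
  induction l with
  | nil => simp [bdryList]
  | cons v l ih => simp [bdryList, reflect_cone, ih]

theorem reflect_bdry (c : Chain E) : reflect (bdry c) = bdry (reflect c) := by
  suffices h : reflect ∘ₗ bdry = bdry ∘ₗ (reflect : Chain E →ₗ[ZMod 2] Chain E) from
    LinearMap.congr_fun h c
  ext l : 2
  simp [reflect_bdryList]

theorem reflect_mem_supported {s t : Set (List E)} {c : Chain E}
    (hc : c ∈ Finsupp.supported (ZMod 2) (ZMod 2) s) (h : ∀ l ∈ s, l.map Neg.neg ∈ t) :
    reflect c ∈ Finsupp.supported (ZMod 2) (ZMod 2) t := by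
  have : reflect c = Finsupp.linearCombination (ZMod 2)
      (fun l => Finsupp.single (l.map Neg.neg) (1 : ZMod 2)) c := by
    simp only [reflect, Finsupp.lmapDomain_apply, Finsupp.mapDomain,
      Finsupp.linearCombination_apply, Finsupp.smul_single, smul_eq_mul, mul_one]
  rw [this]
  exact linearCombination_mem_supported hc fun l hl =>
    Finsupp.single_mem_supported (ZMod 2) _ (h l hl)

/-- The chain of a hemisphere of the cross-polytope with vertices `± e 0, …, ± e k`. -/
def hemisphere (e : ℕ → E) : ℕ → Chain E
  | 0 => Finsupp.single [e 0] 1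
  | k + 1 => cone (e (k + 1)) (hemisphere e k + reflect (hemisphere e k))

/-- The boundary of a hemisphere is the equatorial sphere, which is invariant under reflection, so
the two hemispheres contribute it twice. In dimension 0 the augmentation counts two points. -/
theorem bdry_hemisphere_add (e : ℕ → E) (k : ℕ) :
    bdry (hemisphere e k + reflect (hemisphere e k)) = 0 := by
  induction k with
  | zero => simp [hemisphere, bdryList, ZModModule.add_self]
  | succ k ih =>
    have h : bdry (hemisphere e (k + 1)) = hemisphere e k + reflect (hemisphere e k) := by
      rw [hemisphere, bdry_cone, ih, map_zero, add_zero]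
    rw [map_add, ← reflect_bdry, h, map_add, reflect_reflect,
      add_comm (reflect (hemisphere e k)), ZModModule.add_self]

theorem bdry_hemisphere_succ (e : ℕ → E) (k : ℕ) :
    bdry (hemisphere e (k + 1)) = hemisphere e k + reflect (hemisphere e k) := by
  rw [hemisphere, bdry_cone, bdry_hemisphere_add, map_zero, add_zero]

theorem cup_map_neg {S : List (E → ZMod 2)} (hS : ∀ s ∈ S, ∀ x ≠ 0, s (-x) = s x + 1)
    {l : List E} (hl : ∀ x ∈ l, x ≠ 0) : cup S (l.map Neg.neg) = cup S l := by
  induction S generalizing l with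
  | nil =>
    match l with
    | [] => rfl
    | [x] => rfl
    | x :: y :: l => rfl
  | cons s S ih =>
    match l with
    | [] => rfl
    | [x] => rfl
    | x :: y :: l =>
      have h := ih (fun s hs => hS s (List.mem_cons_of_mem _ hs)) (l := y :: l)
        (fun z hz => hl z (List.mem_cons_of_mem _ hz))
      simp only [List.map_cons] at h
      simp only [List.map_cons, cup, h]
      rw [hS s (by simp) x (hl x (by simp)), hS s (by simp) y (hl y (by simp))]
      congr 1
      calc s x + 1 + (s y + 1) = s x + s y + (1 + 1) := by ring
        _ = s x + s y := by rw [ZModModule.add_self, add_zero]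

/-- `cup S` takes the same value on a simplex and its antipode, while the leading factors add up to
`s x + s (-x) = 1`. Vertices must be nonzero, as no function is antisymmetric at 0. -/
theorem ev_headMul_add_reflect {s : E → ZMod 2} {S : List (E → ZMod 2)}
    (hS : ∀ s' ∈ s :: S, ∀ x ≠ 0, s' (-x) = s' x + 1) {c : Chain E}
    (hc : c ∈ Finsupp.supported (ZMod 2) (ZMod 2) {l : List E | ∀ x ∈ l, x ≠ 0}) :
    ev (headMul s (cup S)) (c + reflect c) = ev (cup S) c := by
  have h1 : ev (headMul s (cup S)) (c + reflect c) =
      ev (fun l => headMul s (cup S) l + headMul s (cup S) (l.map Neg.neg)) c := by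
    suffices h : ev (headMul s (cup S)) ∘ₗ (LinearMap.id + reflect) =
      ev (fun l => headMul s (cup S) l + headMul s (cup S) (l.map Neg.neg)) from
      LinearMap.congr_fun h c
    ext l : 2
    simp
  rw [h1, Finsupp.linearCombination_apply, Finsupp.linearCombination_apply]
  refine Finset.sum_congr rfl fun l hl => ?_
  have hl0 : ∀ x ∈ l, x ≠ 0 := hc hl
  dsimp only
  congr 1
  match l with
  | [] => simp [headMul, cup_nil_right]
  | x :: l =>
    have h2 := cup_map_neg (fun s hs => hS s (List.mem_cons_of_mem _ hs)) hl0
    simp only [List.map_cons] at h2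
    simp only [List.map_cons, headMul, h2]
    rw [hS s (by simp) x (hl0 x (by simp)), ← add_mul, ← add_assoc, ZModModule.add_self, zero_add,
      one_mul]

end Reflect

/-! ### Barycentric subdivision -/

section Subdivision

variable [NormedAddCommGroup E] [NormedSpace ℝ E]

/-- The barycentre of the vertices of a simplex. -/
def bary (l : List E) : E := (l.length : ℝ)⁻¹ • l.sum

/-- Barycentric subdivision of a simplex with `k` vertices. -/
def sdList : ℕ → List E → Chain E
  | 0, l => Finsupp.single l 1
  | k + 1, l => cone (bary l) (Finsupp.linearCombination (ZMod 2) (sdList k) (bdryList l))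

/-- Barycentric subdivision of chains of simplices with `k` vertices. -/
def sd (k : ℕ) : Chain E →ₗ[ZMod 2] Chain E := Finsupp.linearCombination _ (sdList k)

theorem sd_single_succ (k : ℕ) (l : List E) :
    sd (k + 1) (Finsupp.single l 1) = cone (bary l) (sd k (bdryList l)) := by
  simp [sd, sdList]

/-- The index of `sd` counts vertices, so it drops by one under the boundary. In the cone formula
the second term dies because `∂ sd ∂ = sd ∂∂ = 0`. -/
theorem bdry_sd (k : ℕ) (c : Chain E) : bdry (sd (k + 1) c) = sd k (bdry c) := by
  induction k generalizing c with
  | zero =>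
    suffices h : bdry ∘ₗ sd 1 = sd 0 ∘ₗ (bdry : Chain E →ₗ[ZMod 2] Chain E) from
      LinearMap.congr_fun h c
    have h0 : (sd 0 : Chain E →ₗ[ZMod 2] Chain E) = LinearMap.id := by
      ext l : 2
      simp [sd, sdList]
    ext l : 2
    simp [sd_single_succ, bdry_cone, h0, bdry_bdryList]
  | succ k ih =>
    suffices h : bdry ∘ₗ sd (k + 2) = sd (k + 1) ∘ₗ (bdry : Chain E →ₗ[ZMod 2] Chain E) from
      LinearMap.congr_fun h c
    ext l : 2
    simp [sd_single_succ, bdry_cone, ih, bdry_bdryList]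

theorem bary_map_neg (l : List E) : bary (l.map Neg.neg) = -bary l := by
  have : (l.map Neg.neg).sum = -l.sum := by
    induction l with
    | nil => simp
    | cons v l ih => simp [ih, add_comm]
  simp [bary, this]

theorem reflect_sd (k : ℕ) (c : Chain E) : reflect (sd k c) = sd k (reflect c) := by
  induction k generalizing c with
  | zero =>
    suffices h : reflect ∘ₗ sd 0 = sd 0 ∘ₗ (reflect : Chain E →ₗ[ZMod 2] Chain E) from
      LinearMap.congr_fun h c
    ext l : 2
    simp [sd, sdList]
  | succ k ih =>
    suffices h : reflect ∘ₗ sd (k + 1) = sd (k + 1) ∘ₗ (reflect : Chain E →ₗ[ZMod 2] Chain E) from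
      LinearMap.congr_fun h c
    ext l : 2
    simp [sd_single_succ, reflect_cone, ih, reflect_bdryList, bary_map_neg]

theorem sd_one_singleton (v : E) :
    sd 1 (Finsupp.single [v] 1) = Finsupp.single [v] (1 : ZMod 2) := by
  simp [sd, sdList, bdryList, bary]

/-- `v - bary l` is the average of the differences `v - x`; one of the `l.length` terms is `v - v =
0`, which gains the factor `1 - 1/l.length`. -/
theorem dist_bary_le {l : List E} {d : ℝ} (hl : ∀ x ∈ l, ∀ y ∈ l, dist x y ≤ d) {v : E}
    (hv : v ∈ l) : dist v (bary l) ≤ (1 - (l.length : ℝ)⁻¹) * d := by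
  have hlen : 0 < l.length := List.length_pos_of_mem hv
  have hlen' : (l.length : ℝ) ≠ 0 := by positivity
  have key : ∀ l' : List E, (∀ x ∈ l', dist v x ≤ d) →
      ‖(l'.length : ℝ) • v - l'.sum‖ ≤ l'.length * d := by
    intro l' h
    induction l' with
    | nil => simp
    | cons x l' ih =>
      have e : ((x :: l').length : ℝ) • v - (x :: l').sum =
          (v - x) + ((l'.length : ℝ) • v - l'.sum) := by
        simp only [List.length_cons, List.sum_cons, Nat.cast_add, Nat.cast_one, add_smul, one_smul]
        abel
      rw [e]
      refine (norm_add_le _ _).trans ?_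
      have h1 := ih fun y hy => h y (List.mem_cons_of_mem _ hy)
      have h2 := h x (by simp)
      rw [dist_eq_norm] at h2
      simp only [List.length_cons, Nat.cast_add, Nat.cast_one]
      linarith
  obtain ⟨l₁, l₂, rfl⟩ := List.append_of_mem hv
  have h3 := key (l₁ ++ l₂) fun x hx => hl v hv x (by
    rcases List.mem_append.1 hx with h | h <;> simp [h])
  have e : v - bary (l₁ ++ v :: l₂) = ((l₁ ++ v :: l₂).length : ℝ)⁻¹ •
      (((l₁ ++ l₂).length : ℝ) • v - (l₁ ++ l₂).sum) := by
    have h4 : v = ((l₁ ++ v :: l₂).length : ℝ)⁻¹ • (((l₁ ++ v :: l₂).length : ℝ) • v) := by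
      rw [smul_smul, inv_mul_cancel₀ hlen', one_smul]
    refine (congrArg (· - bary (l₁ ++ v :: l₂)) h4).trans ?_
    rw [bary, ← smul_sub]
    congr 1
    simp only [List.length_append, List.length_cons, List.sum_append, List.sum_cons, Nat.cast_add,
      Nat.cast_one, add_smul, one_smul]
    abel
  rw [dist_eq_norm, e, norm_smul, norm_inv, Real.norm_natCast]
  calc _ ≤ ((l₁ ++ v :: l₂).length : ℝ)⁻¹ * ((l₁ ++ l₂).length * d) := by gcongr
    _ = _ := by
      have h5 : ((l₁ ++ l₂).length : ℝ) = (l₁ ++ v :: l₂).length - 1 := by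
        simp only [List.length_append, List.length_cons, Nat.cast_add, Nat.cast_one]; ring
      rw [h5]; field_simp

/-- The simplices with `k` vertices, diameter at most `d`, inside one of the sets of `𝒞`. -/
def smallSimplices (𝒞 : Set (Set E)) (k : ℕ) (d : ℝ) : Set (List E) :=
  {l | l.length = k ∧ (∃ C ∈ 𝒞, ∀ x ∈ l, x ∈ C) ∧ ∀ x ∈ l, ∀ y ∈ l, dist x y ≤ d}

theorem sdList_mem_supported {q d : ℝ} (hd : 0 ≤ d) (k : ℕ) (hk : 0 < k → 1 - (k : ℝ)⁻¹ ≤ q) {l : List E}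
    (hlk : l.length = k) (hl : ∀ x ∈ l, ∀ y ∈ l, dist x y ≤ d) :
    sdList k l ∈ Finsupp.supported (ZMod 2) (ZMod 2)
      (smallSimplices {convexHull ℝ {x | x ∈ l}} k (q * d)) := by
  induction k generalizing l with
  | zero =>
    refine Finsupp.single_mem_supported _ _ ?_
    obtain rfl := List.length_eq_zero_iff.1 hlk
    simp [smallSimplices]
  | succ k ih =>
    -- `1 - 1/k` increases with `k`, so the contraction ratio of the top dimension also serves for
    -- the faces.
    have hkq : 0 < k → 1 - (k : ℝ)⁻¹ ≤ q := by
      intro hk0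
      refine le_trans ?_ (hk k.succ_pos)
      push_cast
      gcongr
      linarith
    refine cone_mem_supported (linearCombination_mem_supported (bdryList_mem_supported l)
      (t := smallSimplices {convexHull ℝ {x | x ∈ l}} k (q * d)) ?_) ?_
    · rintro l' ⟨h1, h2⟩
      refine Finsupp.supported_mono ?_ (ih hkq (by omega)
        fun x hx y hy => hl x (h2 x hx) y (h2 y hy))
      rintro l'' ⟨h3, ⟨C, rfl, h4⟩, h5⟩
      exact ⟨h3, ⟨_, rfl, fun x hx => convexHull_mono (fun y hy => h2 y hy) (h4 x hx)⟩, h5⟩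
    · rintro l' ⟨h3, ⟨C, rfl, h4⟩, h5⟩
      -- Balls are convex, so it is enough to bound the distance from the barycentre to the
      -- vertices.
      have hball : convexHull ℝ {x | x ∈ l} ⊆ Metric.closedBall (bary l) (q * d) := by
        refine convexHull_min (fun x hx => ?_) (convex_closedBall _ _)
        refine (dist_bary_le hl hx).trans ?_
        rw [hlk]
        have := hk k.succ_pos
        gcongr
      have hb : bary l ∈ convexHull ℝ {x | x ∈ l} := by
        have hpos : (0 : ℝ) < l.length := by rw [hlk]; positivity
        have h := (convex_convexHull ℝ {x | x ∈ l}).sum_mem (t := Finset.univ)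
          (w := fun _ : Fin l.length => (l.length : ℝ)⁻¹) (z := fun i => l[i])
          (fun _ _ => by positivity) (by simp [hpos.ne'])
          (fun i _ => subset_convexHull ℝ _ (List.getElem_mem i.2))
        rw [← Finset.smul_sum] at h
        rw [bary, ← Fin.sum_univ_getElem]
        exact h
      have hqd : 0 ≤ q * d := dist_nonneg.trans (hball hb)
      refine ⟨by simp [h3], ⟨_, rfl, ?_⟩, ?_⟩
      · rintro x hx
        rcases List.mem_cons.1 hx with rfl | hx
        exacts [hb, h4 x hx]
      · intro x hx y hy
        rcases List.mem_cons.1 hx with rfl | hx <;> rcases List.mem_cons.1 hy with rfl | hy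
        · simpa using hqd
        · rw [dist_comm]; exact hball (h4 y hy)
        · exact hball (h4 x hx)
        · exact h5 x hx y hy

end Subdivision

end ListChain
-- Iterated subdivisions of the hemispheres
namespace ListChain
variable {E : Type*} [NormedAddCommGroup E] [NormedSpace ℝ E]

theorem sd_mem_supported {𝒞 : Set (Set E)} (h𝒞 : ∀ C ∈ 𝒞, Convex ℝ C) {q d : ℝ} (hd : 0 ≤ d)
    {k : ℕ} (hk : 0 < k → 1 - (k : ℝ)⁻¹ ≤ q) {c : Chain E}
    (hc : c ∈ Finsupp.supported (ZMod 2) (ZMod 2) (smallSimplices 𝒞 k d)) :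
    sd k c ∈ Finsupp.supported (ZMod 2) (ZMod 2) (smallSimplices 𝒞 k (q * d)) := by
  refine linearCombination_mem_supported hc ?_
  rintro l ⟨h1, ⟨C, hC, h2⟩, h3⟩
  refine Finsupp.supported_mono ?_ (sdList_mem_supported hd k hk h1 h3)
  rintro l' ⟨h4, ⟨_, rfl, h5⟩, h6⟩
  exact ⟨h4, ⟨C, hC, fun x hx => convexHull_min (fun y hy => h2 y hy) (h𝒞 C hC) (h5 x hx)⟩, h6⟩

theorem sd_iterate_mem_supported {𝒞 : Set (Set E)} (h𝒞 : ∀ C ∈ 𝒞, Convex ℝ C) {q d : ℝ}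
    (hd : 0 ≤ d) (hq : 0 ≤ q) {k : ℕ} (hk : 0 < k → 1 - (k : ℝ)⁻¹ ≤ q) {c : Chain E}
    (hc : c ∈ Finsupp.supported (ZMod 2) (ZMod 2) (smallSimplices 𝒞 k d)) (N : ℕ) :
    (sd k)^[N] c ∈ Finsupp.supported (ZMod 2) (ZMod 2) (smallSimplices 𝒞 k (q ^ N * d)) := by
  induction N with
  | zero => simpa using hc
  | succ N ih =>
    rw [Function.iterate_succ_apply', pow_succ', mul_assoc]
    exact sd_mem_supported h𝒞 (by positivity) hk ih

theorem bdry_sd_iterate_hemisphere (e : ℕ → E) (k N : ℕ) :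
    bdry ((sd (k + 2))^[N] (hemisphere e (k + 1))) =
      (sd (k + 1))^[N] (hemisphere e k) + reflect ((sd (k + 1))^[N] (hemisphere e k)) := by
  induction N with
  | zero => simpa using bdry_hemisphere_succ e k
  | succ N ih =>
    rw [Function.iterate_succ_apply', bdry_sd, ih, map_add, Function.iterate_succ_apply',
      reflect_sd]

/-- Induction on the dimension: by Stokes `δs ⌣ cup S` on a hemisphere is `s ⌣ cup S` on its
boundary, that is, on a lower hemisphere plus its reflection. Antisymmetry turns this into `cup S`
on the lower hemisphere, and the descent ends at a single vertex with value 1. -/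
theorem ev_cup_sd_iterate_hemisphere (e : ℕ → E) (N : ℕ) {S : List (E → ZMod 2)}
    (hS : ∀ s ∈ S, ∀ x ≠ 0, s (-x) = s x + 1)
    (h0 : ∀ k < S.length, (sd (k + 1))^[N] (hemisphere e k) ∈
      Finsupp.supported (ZMod 2) (ZMod 2) {l : List E | ∀ x ∈ l, x ≠ 0}) :
    ev (cup S) ((sd (S.length + 1))^[N] (hemisphere e S.length)) = 1 := by
  induction S with
  | nil =>
    have h : (sd 1)^[N] (hemisphere e 0) = Finsupp.single [e 0] 1 := by
      induction N with
      | zero => rfl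
      | succ N ih =>
        rw [Function.iterate_succ_apply', ih (by simp), sd_one_singleton]
    simp [h, cup]
  | cons s S ih =>
    rw [List.length_cons, ← ev_headMul_bdry, bdry_sd_iterate_hemisphere,
      ev_headMul_add_reflect hS (h0 _ (by simp))]
    exact ih (fun s hs => hS s (List.mem_cons_of_mem _ hs))
      fun k hk => h0 k (hk.trans (by simp))

/-- The simplices whose vertices are the vectors `ε i • e i` for a choice of signs `ε`. -/
theorem hemisphere_mem_supported (e : ℕ → E) (k : ℕ) :
    hemisphere e k ∈ Finsupp.supported (ZMod 2) (ZMod 2)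
      {l : List E | l.length = k + 1 ∧ ∃ ε : ℕ → ℝ, (∀ i, |ε i| = 1) ∧
        ∀ x ∈ l, ∃ i ≤ k, x = ε i • e i} := by
  induction k with
  | zero =>
    refine Finsupp.single_mem_supported _ _ ⟨rfl, fun _ => 1, by simp, fun x hx => ⟨0, le_rfl, ?_⟩⟩
    simpa using hx
  | succ k ih =>
    refine cone_mem_supported (Submodule.add_mem _ ih (reflect_mem_supported ih ?_)) ?_
    · rintro l ⟨h1, ε, h2, h3⟩
      refine ⟨by simpa using h1, fun i => -ε i, by simpa using h2, ?_⟩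
      intro x hx
      obtain ⟨y, hy, rfl⟩ := List.mem_map.1 hx
      obtain ⟨i, hi, rfl⟩ := h3 y hy
      exact ⟨i, hi, by simp⟩
    · rintro l ⟨h1, ε, h2, h3⟩
      refine ⟨by simpa using h1, Function.update ε (k + 1) 1, fun i => ?_, ?_⟩
      · rcases eq_or_ne i (k + 1) with rfl | hi
        · simp
        · simpa [Function.update_of_ne hi] using h2 i
      · intro x hx
        rcases List.mem_cons.1 hx with rfl | hx
        · exact ⟨k + 1, le_rfl, by simp⟩
        · obtain ⟨i, hi, rfl⟩ := h3 x hx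
          exact ⟨i, hi.trans k.le_succ, by rw [Function.update_of_ne (by omega)]⟩

end ListChain

/-! ### The Borsuk–Ulam theorem -/

namespace BorsukUlam

open ListChain

/-- The sign of the odd function `F`, completed to an antisymmetric function at the zeros. -/
def oddSign {E : Type*} [AddCommGroup E] (F : E → ℝ) (x : E) : ZMod 2 :=
  open Classical in
  if 0 < F x then 1 else if F x < 0 then 0 else if WellOrderingRel x (-x) then 1 else 0

/-- Where `F` vanishes, the well-order selects exactly one of `x` and `-x`. The signs need no
continuity. -/
theorem oddSign_neg {E : Type*} [AddCommGroup E] [Module ℝ E] {F : E → ℝ}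
    (hF : ∀ x, F (-x) = -F x) {x : E} (hx : x ≠ 0) : oddSign F (-x) = oddSign F x + 1 := by
  have h11 : (1 : ZMod 2) + 1 = 0 := by decide
  unfold oddSign
  rw [hF, neg_neg]
  rcases lt_trichotomy (F x) 0 with h | h | h
  · simp [h, h.not_gt]
  · have hne : x ≠ -x := fun h => hx <| by
      have h2 : (2 : ℝ) • x = 0 := by rw [two_smul, ← eq_neg_iff_add_eq_zero]; exact h
      exact (smul_eq_zero.1 h2).resolve_left two_ne_zero
    rcases trichotomous_of WellOrderingRel x (-x) with h1 | h1 | h1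
    · simp [h, h1, asymm_of WellOrderingRel h1, h11]
    · exact absurd h1 hne
    · simp [h, h1, asymm_of WellOrderingRel h1]
  · simp [h, h.not_gt, h11]

theorem oddSign_eq_one {E : Type*} [AddCommGroup E] {F : E → ℝ} {x : E} (h : 0 < F x) :
    oddSign F x = 1 := by simp [oddSign, h]

theorem oddSign_eq_zero {E : Type*} [AddCommGroup E] {F : E → ℝ} {x : E} (h : F x < 0) :
    oddSign F x = 0 := by simp [oddSign, h, h.not_gt]

theorem exists_zero_of_odd {m : ℕ} {ι : Type*} [Fintype ι] (hι : Fintype.card ι ≤ m)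
    {F : EuclideanSpace ℝ (Fin (m + 1)) → ι → ℝ} (hF : ContinuousOn F {0}ᶜ)
    (hodd : ∀ x, F (-x) = -F x) : ∃ x ≠ 0, F x = 0 := by
  by_contra! hne
  -- A compact set away from 0 that contains the surface of the cross-polytope and all its
  -- subdivisions.
  set K : Set (EuclideanSpace ℝ (Fin (m + 1))) :=
    {x | ‖x‖ ≤ 1 ∧ 1 ≤ ∑ i, |x i|} with hK
  have hK0 : K ⊆ {0}ᶜ := by
    rintro x ⟨-, hx⟩ rfl
    norm_num at hx
  have hKc : IsCompact K := by
    have hcl : IsClosed {x : EuclideanSpace ℝ (Fin (m + 1)) | 1 ≤ ∑ i, |x i|} :=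
      isClosed_le continuous_const (by fun_prop)
    have : K = Metric.closedBall 0 1 ∩ {x | 1 ≤ ∑ i, |x i|} := by
      ext x; simp [hK]
    rw [this]
    exact (isCompact_closedBall _ _).inter_right hcl
  have hFK : ContinuousOn F K := hF.mono hK0
  obtain ⟨η, hη, hηK⟩ : ∃ η > 0, ∀ x ∈ K, η ≤ ‖F x‖ := by
    rcases K.eq_empty_or_nonempty with he | hn
    · exact ⟨1, one_pos, by simp [he]⟩
    · obtain ⟨x, hx, hmin⟩ := hKc.exists_isMinOn hn hFK.norm
      exact ⟨‖F x‖, norm_pos_iff.2 (hne x (hK0 hx)), fun y hy => hmin hy⟩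
  obtain ⟨δ, hδ, hδK⟩ := Metric.uniformContinuousOn_iff.1
    (hKc.uniformContinuousOn_of_continuous hFK) η hη
  set p := Fintype.card ι with hp
  -- One convex piece of `K` for each choice of signs; it contains the corresponding face of the
  -- cross-polytope, and by convexity subdivision never leaves it.
  set 𝒞 : Set (Set (EuclideanSpace ℝ (Fin (m + 1)))) :=
    {C | ∃ ε : ℕ → ℝ, (∀ i, |ε i| = 1) ∧ C = {x | ‖x‖ ≤ 1 ∧ 1 ≤ ∑ i : Fin (m + 1), ε i * x i}}
    with h𝒞
  have h𝒞conv : ∀ C ∈ 𝒞, Convex ℝ C := by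
    rintro C ⟨ε, -, rfl⟩
    have h1 : Convex ℝ (Metric.closedBall (0 : EuclideanSpace ℝ (Fin (m + 1))) 1) :=
      convex_closedBall _ _
    have h2 : Convex ℝ {x : EuclideanSpace ℝ (Fin (m + 1)) | 1 ≤ ∑ i : Fin (m + 1), ε i * x i} := by
      refine convex_halfSpace_ge ⟨fun x y => ?_, fun c x => ?_⟩ 1
      · simp [mul_add, Finset.sum_add_distrib]
      · simp only [PiLp.smul_apply, smul_eq_mul, Finset.mul_sum]
        exact Finset.sum_congr rfl fun i _ => by ring
    have h3 := h1.inter h2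
    convert h3 using 1
    ext x
    simp
  have h𝒞K : ∀ C ∈ 𝒞, C ⊆ K := by
    rintro C ⟨ε, hε, rfl⟩ x ⟨h1, h2⟩
    refine ⟨h1, h2.trans (Finset.sum_le_sum fun i _ => ?_)⟩
    calc ε i * x i ≤ |ε i * x i| := le_abs_self _
      _ = |x i| := by rw [abs_mul, hε, one_mul]
  set e : ℕ → EuclideanSpace ℝ (Fin (m + 1)) := fun k => EuclideanSpace.single (Fin.ofNat (m + 1) k) 1
    with he
  have hstart : ∀ k ≤ p, hemisphere e k ∈
      Finsupp.supported (ZMod 2) (ZMod 2) (smallSimplices 𝒞 (k + 1) 2) := by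
    intro k hk
    refine Finsupp.supported_mono ?_ (hemisphere_mem_supported e k)
    rintro l ⟨h1, ε, h2, h3⟩
    have h4 : ∀ x ∈ l, ‖x‖ = 1 := by
      intro x hx
      obtain ⟨i, hi, rfl⟩ := h3 x hx
      simp [he, norm_smul, h2]
    refine ⟨h1, ⟨_, ⟨ε, h2, rfl⟩, fun x hx => ⟨(h4 x hx).le, ?_⟩⟩, fun x hx y hy => ?_⟩
    · obtain ⟨i, hi, rfl⟩ := h3 x hx
      have him : i < m + 1 := by omega
      rw [Finset.sum_eq_single (Fin.ofNat (m + 1) i)]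
      · have h5 : ((Fin.ofNat (m + 1) i : Fin (m + 1)) : ℕ) = i := by
          simp [Nat.mod_eq_of_lt him]
        rw [h5]
        have := h2 i
        simp only [he, PiLp.smul_apply, PiLp.single_apply, if_true, smul_eq_mul, mul_one]
        rw [← abs_mul_abs_self, this, one_mul]
      · intro j _ hj
        have h6 : e i j = 0 := by
          rw [he]
          exact (PiLp.single_apply 2 ℝ _ _ _).trans (if_neg hj)
        rw [PiLp.smul_apply, h6, smul_zero, mul_zero]
      · simp
    · calc dist x y ≤ ‖x‖ + ‖y‖ := by rw [dist_eq_norm]; exact norm_sub_le _ _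
        _ = 2 := by rw [h4 x hx, h4 y hy]; norm_num
  -- The contraction ratio for simplices with `p + 1` vertices, the largest in use.
  set q : ℝ := 1 - ((p : ℝ) + 1)⁻¹ with hq
  have hq0 : 0 ≤ q := by
    rw [hq, sub_nonneg]
    exact inv_le_one_of_one_le₀ (by linarith [p.cast_nonneg (α := ℝ)])
  have hq1 : q < 1 := by rw [hq]; linarith [inv_pos.2 (show (0 : ℝ) < p + 1 by positivity)]
  obtain ⟨N, hN⟩ := exists_pow_lt_of_lt_one (show 0 < δ / 2 by positivity) hq1
  have hsmall : ∀ k ≤ p, (sd (k + 1))^[N] (hemisphere e k) ∈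
      Finsupp.supported (ZMod 2) (ZMod 2) (smallSimplices 𝒞 (k + 1) (q ^ N * 2)) := by
    intro k hk
    refine sd_iterate_mem_supported h𝒞conv zero_le_two hq0 (fun _ => ?_) (hstart k hk) N
    rw [hq]
    push_cast
    gcongr
  set S := (Finset.univ : Finset ι).toList.map fun i => oddSign fun x => F x i with hS
  have hSlen : S.length = p := by simp [hS, hp]
  have hev := ev_cup_sd_iterate_hemisphere e N (S := S) ?_ ?_
  · rw [hSlen, Finsupp.linearCombination_apply] at hev
    obtain ⟨l, hl, hl0⟩ := Finset.exists_ne_zero_of_sum_ne_zero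
      (show Finsupp.sum _ _ ≠ (0 : ZMod 2) by rw [hev]; exact one_ne_zero)
    have hcup := exists_ne_of_cup_ne_zero (right_ne_zero_of_mul hl0)
    obtain ⟨h1, ⟨C, hC, h2⟩, h3⟩ := hsmall p le_rfl hl
    obtain ⟨z, hz⟩ := List.exists_mem_of_length_pos (l := l) (by omega)
    have hzK := h𝒞K C hC (h2 z hz)
    -- In the sup norm some coordinate of `F z` has size at least `η`. The other vertices differ
    -- from it by less than `η`, so this coordinate has one strict sign on the whole simplex.
    obtain ⟨i, hi⟩ : ∃ i, η ≤ |F z i| := by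
      by_contra! hlt
      exact (hηK z hzK).not_gt ((pi_norm_lt_iff hη).2 hlt)
    have hclose : ∀ x ∈ l, |F x i - F z i| < η := by
      intro x hx
      have h4 := hδK x (h𝒞K C hC (h2 x hx)) z hzK ((h3 x hx z hz).trans_lt (by linarith))
      exact (dist_le_pi_dist (F x) (F z) i).trans_lt h4
    obtain ⟨x, hx, y, hy, hxy⟩ := hcup (oddSign fun x => F x i) (by simp [hS])
    refine hxy ?_
    have hx' := abs_lt.1 (hclose x hx)
    have hy' := abs_lt.1 (hclose y hy)
    rcases le_abs.1 hi with h | h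
    · rw [oddSign_eq_one (by linarith), oddSign_eq_one (by linarith)]
    · rw [oddSign_eq_zero (by linarith), oddSign_eq_zero (by linarith)]
  · intro s hs x hx
    obtain ⟨i, -, rfl⟩ := List.mem_map.1 hs
    exact oddSign_neg (fun x => by simp [hodd]) hx
  · intro k hk
    refine Finsupp.supported_mono ?_ (hsmall k (by omega))
    rintro l ⟨-, ⟨C, hC, h2⟩, -⟩ x hx
    exact hK0 (h𝒞K C hC (h2 x hx))

/-- The radial projection to the unit sphere. -/
def toSphere {m : ℕ} (x : {x : EuclideanSpace ℝ (Fin (m + 1)) // x ≠ 0}) : UnitSphere m :=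
  ⟨‖x.1‖⁻¹ • x.1, by simp [norm_smul, x.2]⟩

theorem continuous_toSphere {m : ℕ} : Continuous (toSphere (m := m)) :=
  Continuous.subtype_mk ((continuous_subtype_val.norm.inv₀ fun x => norm_ne_zero_iff.2 x.2).smul
    continuous_subtype_val) _

open Classical in
/-- The extension of a function on the sphere that is constant on open rays. -/
def radialExt {m : ℕ} {ι : Type*} (f : UnitSphere m → ι → ℝ)
    (x : EuclideanSpace ℝ (Fin (m + 1))) : ι → ℝ :=
  if h : x = 0 then 0 else f (toSphere ⟨x, h⟩)

/-- The Borsuk–Ulam theorem. -/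
theorem exists_zero_of_odd_sphere {m : ℕ} {ι : Type*} [Fintype ι] (hι : Fintype.card ι ≤ m)
    {f : UnitSphere m → ι → ℝ} (hf : Continuous f) (hodd : ∀ x, f (-x) = -f x) :
    ∃ x, f x = 0 := by
  have hc : ContinuousOn (radialExt f) {0}ᶜ := by
    rw [continuousOn_iff_continuous_domRestrict]
    exact (hf.comp continuous_toSphere).congr fun x =>
      (dif_neg x.2 : radialExt f x.1 = f (toSphere ⟨x.1, x.2⟩)).symm
  have ho : ∀ x, radialExt f (-x) = -radialExt f x := by
    intro x
    by_cases hx : x = 0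
    · simp [radialExt, hx]
    · have h : toSphere ⟨-x, neg_ne_zero.2 hx⟩ = -toSphere ⟨x, hx⟩ := Subtype.ext (by simp [toSphere])
      simp only [radialExt, neg_eq_zero, hx, dite_false]
      rw [h, hodd]
  obtain ⟨x, hx, hx0⟩ := exists_zero_of_odd hι hc ho
  exact ⟨toSphere ⟨x, hx⟩, by simpa [radialExt, hx] using hx0⟩

end BorsukUlam

/-! ### The upper bound -/

namespace CircleMaps

namespace SmoothMap

/-- The derivative of a smooth map, with one-sided derivatives at the endpoints. -/
def dfn (h : SmoothMap) (x : ℝ) : ℂ := derivWithin h.fn (Icc (0 : ℝ) 1) x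

theorem continuousOn_dfn (h : SmoothMap) : ContinuousOn h.dfn (Icc (0 : ℝ) 1) :=
  h.contDiffOn_fn.continuousOn_derivWithin (uniqueDiffOn_Icc zero_lt_one) (by simp)

theorem hasDerivWithinAt_fn (h : SmoothMap) {x : ℝ} (hx : x ∈ Icc (0 : ℝ) 1) :
    HasDerivWithinAt h.fn (h.dfn x) (Icc 0 1) x :=
  ((h.contDiffOn_fn.differentiableOn (by simp)) x hx).hasDerivWithinAt

theorem norm_fn (h : SmoothMap) (x : ℝ) : ‖h.fn x‖ = 1 := by
  simpa [fn, IccExtend] using Circle.norm_coe _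

theorem w11Norm_eq (h : SmoothMap) : h.w11Norm = 1 + ∫ x in (0 : ℝ)..1, ‖h.dfn x‖ := by
  simp [w11Norm, norm_fn, dfn]

/-- The angular speed. -/
def speed (h : SmoothMap) (x : ℝ) : ℝ := (starRingEnd ℂ (h.fn x) * h.dfn x).im

theorem continuousOn_speed (h : SmoothMap) : ContinuousOn h.speed (Icc (0 : ℝ) 1) :=
  Complex.continuous_im.comp_continuousOn
    ((Complex.continuous_conj.comp_continuousOn h.contDiffOn_fn.continuousOn).mul
      h.continuousOn_dfn)

theorem conj_fn_mul_fn (h : SmoothMap) (x : ℝ) : starRingEnd ℂ (h.fn x) * h.fn x = 1 := by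
  rw [mul_comm, Complex.mul_conj, Complex.normSq_eq_norm_sq, norm_fn]; simp

/-- Differentiating `|h|² = 1` shows that `conj h * h'` is purely imaginary. -/
theorem dfn_eq (h : SmoothMap) {x : ℝ} (hx : x ∈ Icc (0 : ℝ) 1) :
    h.dfn x = h.speed x * Complex.I * h.fn x := by
  have h1 := (h.hasDerivWithinAt_fn hx).norm_sq
  have h2 : HasDerivWithinAt (fun y => ‖h.fn y‖ ^ 2) 0 (Icc (0 : ℝ) 1) x := by
    simpa [norm_fn] using hasDerivWithinAt_const x (Icc (0 : ℝ) 1) (1 : ℝ)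
  have h3 := (uniqueDiffOn_Icc zero_lt_one x hx).eq_deriv _ h1 h2
  rw [Complex.inner, mul_comm (h.dfn x)] at h3
  have h4 : (starRingEnd ℂ (h.fn x) * h.dfn x).re = 0 := by linarith
  have h5 : starRingEnd ℂ (h.fn x) * h.dfn x = h.speed x * Complex.I := by
    apply Complex.ext <;> simp [h4, speed]
  rw [← h5]
  calc h.dfn x = (starRingEnd ℂ (h.fn x) * h.fn x) * h.dfn x := by rw [conj_fn_mul_fn, one_mul]
    _ = _ := by ring

theorem norm_dfn (h : SmoothMap) {x : ℝ} (hx : x ∈ Icc (0 : ℝ) 1) : ‖h.dfn x‖ = |h.speed x| := by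
  rw [dfn_eq h hx]; simp [norm_fn]

/-- The angle swept since time `a`. -/
def angle (h : SmoothMap) (a x : ℝ) : ℝ := ∫ t in a..x, h.speed t

theorem intervalIntegrable_speed {a b : ℝ} (ha : 0 ≤ a) (hb : b ≤ 1) (h : SmoothMap) {x y : ℝ} (hx : x ∈ Icc a b) (hy : y ∈ Icc a b) :
    IntervalIntegrable h.speed MeasureTheory.volume x y := by
  refine (h.continuousOn_speed.mono ?_).intervalIntegrable
  exact (uIcc_subset_Icc hx hy).trans (Icc_subset_Icc ha hb)

theorem hasDerivWithinAt_angle {a b : ℝ} (ha : 0 ≤ a) (hb : b ≤ 1) (h : SmoothMap) {x : ℝ} (hx : x ∈ Ico a b) :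
    HasDerivWithinAt (h.angle a) (h.speed x) (Ici x) x := by
  have hx' : x ∈ Icc a b := Ico_subset_Icc_self hx
  have hc : ContinuousWithinAt h.speed (Ici x) x := by
    refine (h.continuousOn_speed x ⟨ha.trans hx.1, hx.2.le.trans hb⟩).mono_of_mem_nhdsWithin ?_
    exact Filter.mem_of_superset (Icc_mem_nhdsGE hx.2) (Icc_subset_Icc (ha.trans hx.1) hb)
  refine intervalIntegral.integral_hasDerivWithinAt_right
    (h.intervalIntegrable_speed ha hb ⟨le_rfl, hx.1.trans hx.2.le⟩ hx') (t := Ioi x) ?_ ?_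
  · refine ⟨Ioc x b, Ioc_mem_nhdsGT hx.2, ?_⟩
    exact (h.continuousOn_speed.mono fun y hy =>
      ⟨ha.trans (hx.1.trans hy.1.le), hy.2.trans hb⟩).aestronglyMeasurable measurableSet_Ioc
  · exact hc.mono Ioi_subset_Ici_self

/-- `h * exp (-i * angle)` has right derivative zero, hence is constant. -/
theorem fn_eq {a b : ℝ} (ha : 0 ≤ a) (hb : b ≤ 1) (h : SmoothMap) {x : ℝ} (hx : x ∈ Icc a b) :
    h.fn x = h.fn a * Complex.exp (h.angle a x * Complex.I) := by
  have hab : a ≤ b := hx.1.trans hx.2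
  have hcont : ContinuousOn (h.angle a) (Icc a b) := by
    have := intervalIntegral.continuousOn_primitive_interval'
      (h.intervalIntegrable_speed ha hb (left_mem_Icc.2 hab) (right_mem_Icc.2 hab)) left_mem_uIcc
    rwa [uIcc_of_le hab] at this
  have key := constant_of_has_deriv_right_zero
    (f := fun x => h.fn x * Complex.exp (-(h.angle a x * Complex.I))) (a := a) (b := b) ?_ ?_ x hx
  · simp only [angle, intervalIntegral.integral_same, Complex.ofReal_zero, zero_mul, neg_zero,
      Complex.exp_zero, mul_one] at key
    rw [← key, mul_assoc, ← Complex.exp_add]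
    simp [angle]
  · refine (h.contDiffOn_fn.continuousOn.mono (Icc_subset_Icc ha hb)).mul ?_
    fun_prop
  · intro y hy
    have hy' : y ∈ Icc (0 : ℝ) 1 := ⟨ha.trans hy.1, hy.2.le.trans hb⟩
    have h1 : HasDerivWithinAt h.fn (h.dfn y) (Ici y) y :=
      (h.hasDerivWithinAt_fn hy').mono_of_mem_nhdsWithin
        (Filter.mem_of_superset (Icc_mem_nhdsGE hy.2) (Icc_subset_Icc hy'.1 hb))
    have h2 := ((h.hasDerivWithinAt_angle ha hb hy).ofReal_comp.mul_const Complex.I).neg.cexp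
    refine (h1.mul h2).congr_deriv ?_
    rw [h.dfn_eq hy']
    simp
    ring

/-- A smooth map with mean zero on `[a, b]` has variation more than `π` there. -/
theorem pi_lt_integral_norm_dfn {a b : ℝ} (ha : 0 ≤ a) (hb : b ≤ 1) (h : SmoothMap) (hab : a < b)
    (h0 : ∫ x in a..b, h.fn x = 0) : Real.pi < ∫ x in a..b, ‖h.dfn x‖ := by
  by_contra! hle
  have hsub : Icc a b ⊆ Icc 0 1 := Icc_subset_Icc ha hb
  have hint : ∀ x ∈ Icc a b, ∀ y ∈ Icc a b, |h.angle a y - h.angle a x| ≤ Real.pi := by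
    intro x hx y hy
    wlog hxy : x ≤ y generalizing x y
    · rw [abs_sub_comm]; exact this y hy x hx (le_of_not_ge hxy)
    have haI : a ∈ Icc a b := left_mem_Icc.2 hab.le
    have h1 : h.angle a y - h.angle a x = ∫ t in x..y, h.speed t :=
      intervalIntegral.integral_interval_sub_left (h.intervalIntegrable_speed ha hb haI hy)
        (h.intervalIntegrable_speed ha hb haI hx)
    rw [h1, ← Real.norm_eq_abs]
    refine (intervalIntegral.norm_integral_le_integral_norm hxy).trans (le_trans ?_ hle)
    have h2 : ∫ t in a..b, ‖h.dfn t‖ = ∫ t in a..b, ‖h.speed t‖ :=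
      intervalIntegral.integral_congr fun t ht => by
        rw [uIcc_of_le hab.le] at ht
        exact h.norm_dfn (hsub ht)
    rw [h2]
    refine intervalIntegral.integral_mono_interval hx.1 hxy hy.2
      (Filter.Eventually.of_forall fun t => norm_nonneg _)
      (h.intervalIntegrable_speed ha hb haI (right_mem_Icc.2 hab.le)).norm
  have hcont : ContinuousOn (h.angle a) (Icc a b) := by
    have := intervalIntegral.continuousOn_primitive_interval'
      (h.intervalIntegrable_speed ha hb (left_mem_Icc.2 hab.le) (right_mem_Icc.2 hab.le))
      left_mem_uIcc
    rwa [uIcc_of_le hab.le] at this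
  obtain ⟨x₁, hx₁, hmin⟩ := isCompact_Icc.exists_isMinOn (nonempty_Icc.2 hab.le) hcont
  obtain ⟨x₂, hx₂, hmax⟩ := isCompact_Icc.exists_isMaxOn (nonempty_Icc.2 hab.le) hcont
  -- The angle ranges over an interval of length at most `π`; with `m` its midpoint, the cosine of
  -- `angle - m` is nonnegative.
  set m := (h.angle a x₁ + h.angle a x₂) / 2 with hm
  have hdiff := (abs_le.1 (hint x₁ hx₁ x₂ hx₂)).2
  have hg : ContinuousOn (fun x => Real.cos (h.angle a x - m)) (Icc a b) := by fun_prop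
  have hg0 : ∀ x ∈ Ioc a b, 0 ≤ Real.cos (h.angle a x - m) := by
    intro x hx
    have hx' := Ioc_subset_Icc_self hx
    have h1 : h.angle a x₁ ≤ h.angle a x := hmin hx'
    have h2 : h.angle a x ≤ h.angle a x₂ := hmax hx'
    exact Real.cos_nonneg_of_neg_pi_div_two_le_of_le (by linarith) (by linarith)
  -- The midpoint is attained, and there the cosine is 1; this makes the integral strictly positive.
  obtain ⟨c, hc, hcm⟩ : m ∈ h.angle a '' Icc a b := by
    have h3 : h.angle a x₁ ≤ h.angle a x₂ := hmin hx₂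
    exact (isPreconnected_Icc.image _ hcont).ordConnected.out (mem_image_of_mem _ hx₁)
      (mem_image_of_mem _ hx₂) ⟨by linarith, by linarith⟩
  have hpos := intervalIntegral.integral_pos hab hg hg0 ⟨c, hc, by rw [hcm]; simp⟩
  have hzero : ∫ x in a..b, Real.cos (h.angle a x - m) = 0 := by
    -- The rotation taking the middle direction to 1, so that `Re (u * h)` is the cosine above.
    set u : ℂ := starRingEnd ℂ (h.fn a) * Complex.exp (-(m * Complex.I)) with hu
    have h1 : ∀ x ∈ Icc a b, Real.cos (h.angle a x - m) = (u * h.fn x).re := by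
      intro x hx
      have h2 : u * h.fn x = Complex.exp (((h.angle a x - m : ℝ) : ℂ) * Complex.I) := by
        rw [h.fn_eq ha hb hx]
        calc _ = (starRingEnd ℂ (h.fn a) * h.fn a) * (Complex.exp (-(m * Complex.I)) *
              Complex.exp (h.angle a x * Complex.I)) := by rw [hu]; ring
          _ = _ := by
            rw [conj_fn_mul_fn, one_mul, ← Complex.exp_add]
            congr 1
            push_cast
            ring
      rw [h2, Complex.exp_ofReal_mul_I_re]
    have h3 : IntervalIntegrable h.fn MeasureTheory.volume a b := by
      refine (h.contDiffOn_fn.continuousOn.mono ?_).intervalIntegrable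
      rwa [uIcc_of_le hab.le]
    calc ∫ x in a..b, Real.cos (h.angle a x - m) = ∫ x in a..b, (u * h.fn x).re :=
          intervalIntegral.integral_congr fun x hx => h1 x (by rwa [uIcc_of_le hab.le] at hx)
      _ = (∫ x in a..b, u * h.fn x).re :=
          Complex.reCLM.intervalIntegral_comp_comm (h3.const_mul u)
      _ = 0 := by rw [intervalIntegral.integral_const_mul, h0]; simp
  exact hpos.ne' hzero

theorem continuous_integral {a b : ℝ} (ha : 0 ≤ a) (hab : a ≤ b) (hb : b ≤ 1) :
    Continuous fun h : SmoothMap => ∫ x in a..b, h.fn x := by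
  refine (LipschitzWith.of_dist_le_mul (K := 1) fun h k => ?_).continuous
  have hi : ∀ h : SmoothMap, IntervalIntegrable h.fn MeasureTheory.volume a b := fun h => by
    refine (h.contDiffOn_fn.continuousOn.mono ?_).intervalIntegrable
    rw [uIcc_of_le hab]
    exact Icc_subset_Icc ha hb
  rw [dist_eq_norm, ← intervalIntegral.integral_sub (hi h) (hi k), NNReal.coe_one, one_mul, dist_def]
  refine (intervalIntegral.norm_integral_le_integral_norm hab).trans ?_
  exact intervalIntegral.integral_mono_interval ha hab hb
    (Filter.Eventually.of_forall fun t => norm_nonneg _) (intervalIntegrable_norm_sub h k)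

end SmoothMap

/-! ### Means over equal intervals -/

/-- The mean of `h` over the `j`-th of `n` equal intervals, up to a factor. -/
def pieceMean (n : ℕ) (h : SmoothMap) (j : ℕ) : ℂ :=
  ∫ x in (j / n : ℝ)..((j + 1 : ℕ) / n : ℝ), h.fn x

/-- Otherwise each of the `n` intervals carries variation more than `π`. The strictness is
essential, since norm exactly `1 + πn` is allowed. -/
theorem exists_pieceMean_ne_zero {n : ℕ} (hn : 1 ≤ n) (h : Y n) :
    ∃ j : Fin n, pieceMean n h.1 j ≠ 0 := by
  by_contra! hall
  have hn0 : (0 : ℝ) < n := by exact_mod_cast hn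
  have hle : ∀ j < n, (((j + 1 : ℕ) : ℝ) / n) ≤ 1 := fun j hj => by
    rw [div_le_one hn0]; exact_mod_cast hj
  have hlt : ∀ j : ℕ, (j / n : ℝ) < ((j + 1 : ℕ) / n : ℝ) := fun j => by
    gcongr; exact j.lt_succ_self
  have h1 : ∀ j ∈ Finset.range n, Real.pi <
      ∫ x in (j / n : ℝ)..((j + 1 : ℕ) / n : ℝ), ‖h.1.dfn x‖ := fun j hj =>
    h.1.pi_lt_integral_norm_dfn (by positivity) (hle j (Finset.mem_range.1 hj)) (hlt j)
      (hall ⟨j, Finset.mem_range.1 hj⟩)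
  have h2 := Finset.sum_lt_sum_of_nonempty (Finset.nonempty_range_iff.2 (by omega)) h1
  rw [intervalIntegral.sum_integral_adjacent_intervals (a := fun j : ℕ => (j / n : ℝ))] at h2
  · have h3 := h.2
    rw [SmoothMap.w11Norm_eq] at h3
    simp only [Nat.cast_zero, zero_div, div_self hn0.ne', Finset.sum_const, Finset.card_range,
      nsmul_eq_mul] at h2
    linarith
  · intro j hj
    refine (h.1.continuousOn_dfn.norm.mono ?_).intervalIntegrable
    rw [uIcc_of_le (hlt j).le]
    exact Icc_subset_Icc (by positivity) (hle j hj)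

theorem continuous_pieceMean {n : ℕ} (hn : 1 ≤ n) (j : Fin n) :
    Continuous fun h : SmoothMap => pieceMean n h j := by
  have hn0 : (0 : ℝ) < n := by exact_mod_cast hn
  refine SmoothMap.continuous_integral (by positivity) ?_ ?_
  · gcongr; exact Nat.le_succ _
  · rw [div_le_one hn0]; exact_mod_cast j.2

theorem pieceMean_neg (n : ℕ) (h : SmoothMap) (j : ℕ) : pieceMean n (-h) j = -pieceMean n h j := by
  simp [pieceMean, SmoothMap.fn_neg]

theorem lt_of_odd_map {n m : ℕ} (hn : 1 ≤ n) (f : C(UnitSphere m, Y n))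
    (hf : ∀ x, f (-x) = Y.neg (f x)) : m < 2 * n := by
  by_contra! hm
  have key := BorsukUlam.exists_zero_of_odd_sphere (m := m) (ι := Fin n ⊕ Fin n)
    (by simp; omega)
    (f := fun x => Sum.elim (fun j => (pieceMean n (f x).1 j).re)
      (fun j => (pieceMean n (f x).1 j).im)) ?_ ?_
  · obtain ⟨x, hx⟩ := key
    obtain ⟨j, hj⟩ := exists_pieceMean_ne_zero hn (f x)
    exact hj (Complex.ext (congrFun hx (Sum.inl j)) (congrFun hx (Sum.inr j)))
  · have h1 : ∀ j : Fin n, Continuous fun x => pieceMean n (f x).1 j := fun j =>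
      (continuous_pieceMean hn j).comp (continuous_subtype_val.comp f.continuous)
    refine continuous_pi fun i => ?_
    rcases i with j | j
    · exact Complex.continuous_re.comp (h1 j)
    · exact Complex.continuous_im.comp (h1 j)
  · intro x
    funext i
    rw [hf]
    rcases i with j | j <;> simp [Y.neg, pieceMean_neg]

end CircleMaps

/-! ### The lower bound -/

namespace CircleMaps

open Filter Topology

/-- The phase of a complex number. -/
def phase (z : ℂ) : Circle := Circle.exp z.arg

theorem coe_phase {z : ℂ} (hz : z ≠ 0) : (phase z : ℂ) = z / ‖z‖ := by
  have h : (‖z‖ : ℂ) ≠ 0 := by simpa using hz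
  rw [phase, Circle.coe_exp, eq_div_iff h, mul_comm, Complex.norm_mul_exp_arg_mul_I]

theorem phase_mul {z w : ℂ} (hz : z ≠ 0) (hw : w ≠ 0) : phase (z * w) = phase z * phase w := by
  ext
  rw [Circle.coe_mul, coe_phase hz, coe_phase hw, coe_phase (mul_ne_zero hz hw), norm_mul]
  push_cast
  rw [mul_div_mul_comm]

theorem phase_real_mul {r : ℝ} (hr : 0 < r) (z : ℂ) : phase (r * z) = phase z := by
  rw [phase, Complex.arg_real_mul z hr, phase]

theorem phase_coe (u : Circle) : phase u = u := by
  refine Circle.ext ?_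
  rw [coe_phase (Circle.coe_ne_zero u), Circle.norm_coe, Complex.ofReal_one, div_one]

theorem continuousAt_phase {z : ℂ} (hz : z ≠ 0) : ContinuousAt phase z := by
  refine Topology.IsInducing.subtypeVal.continuousAt_iff.2 ?_
  have h : ContinuousAt (fun w : ℂ => w / (‖w‖ : ℂ)) z :=
    continuousAt_id.div (by fun_prop) (by simpa using hz)
  refine h.congr ?_
  filter_upwards [isOpen_ne.mem_nhds hz] with w hw using (coe_phase hw).symm

/-! ### Transition paths between two phases -/

/-- The relative phase of `v.2` and `v.1`, as a number in `(0, 1]`. -/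
def turn (v : ℂ × ℂ) : ℝ :=
  if v.1 = 0 then 1 else ((-(v.2 * starRingEnd ℂ v.1)).arg + Real.pi) / (2 * Real.pi)

/-- For nonzero entries, `2π * turn v` is the argument of `v.2 / v.1` in `(0, 2π]`: the minus sign
puts the cut where the phases agree, with value 1 there. `turn v` is also the duration of the
transition, so it must not be 0. -/
theorem turn_pos (v : ℂ × ℂ) : 0 < turn v := by
  unfold turn
  split_ifs
  · exact one_pos
  · have := Complex.neg_pi_lt_arg (-(v.2 * starRingEnd ℂ v.1))
    have := Real.pi_pos
    exact div_pos (by linarith) (by positivity)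

theorem turn_le_one (v : ℂ × ℂ) : turn v ≤ 1 := by
  unfold turn
  split_ifs
  · exact le_rfl
  · have := Complex.arg_le_pi (-(v.2 * starRingEnd ℂ v.1))
    have := Real.pi_pos
    exact (div_le_one (by positivity)).2 (by linarith)

/-- The place of the transition from the phase of `v.1` to that of `v.2`. -/
def centre (v : ℂ × ℂ) : ℝ := 2 * (‖v.1‖ - ‖v.2‖) / (‖v.1‖ + ‖v.2‖)

theorem norm_add_norm_pos {v : ℂ × ℂ} (hv : v ≠ 0) : 0 < ‖v.1‖ + ‖v.2‖ := by
  by_contra! h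
  have h1 := norm_nonneg v.1
  have h2 := norm_nonneg v.2
  exact hv (Prod.ext (norm_eq_zero.1 (by linarith)) (norm_eq_zero.1 (by linarith)))

theorem continuousAt_centre {v : ℂ × ℂ} (hv : v ≠ 0) : ContinuousAt centre v := by
  have := (norm_add_norm_pos hv).ne'
  unfold centre
  fun_prop (disch := assumption)

/-- The (decreasing) angle function of the transition. -/
def lift (v : ℂ × ℂ) (t : ℝ) : ℝ :=
  2 * Real.pi * (turn v - 1) * Real.smoothTransition ((t - centre v) / turn v)

theorem contDiff_lift (v : ℂ × ℂ) : ContDiff ℝ ∞ (lift v) := by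
  have h : ContDiff ℝ ∞ fun t : ℝ => (t - centre v) / turn v := by fun_prop
  exact contDiff_const.mul (Real.smoothTransition.contDiff.comp h)

theorem antitone_lift (v : ℂ × ℂ) : Antitone (lift v) := by
  intro s t hst
  have h1 : Real.smoothTransition ((s - centre v) / turn v) ≤
      Real.smoothTransition ((t - centre v) / turn v) :=
    Real.smoothTransition.monotone (by have := turn_pos v; gcongr)
  have h2 : 2 * Real.pi * (turn v - 1) ≤ 0 :=
    mul_nonpos_of_nonneg_of_nonpos (by positivity) (by linarith [turn_le_one v])
  exact mul_le_mul_of_nonpos_left h1 h2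

theorem lift_sub_lift_le (v : ℂ × ℂ) (s t : ℝ) : lift v s - lift v t ≤ 2 * Real.pi := by
  unfold lift
  set a := Real.smoothTransition ((s - centre v) / turn v)
  set b := Real.smoothTransition ((t - centre v) / turn v)
  have ha : 0 ≤ a := Real.smoothTransition.nonneg _
  have hb : b ≤ 1 := Real.smoothTransition.le_one _
  have hb0 : 0 ≤ b := Real.smoothTransition.nonneg _
  have h1 := turn_pos v
  have h2 := turn_le_one v
  have h3 : (1 - turn v) * (b - a) ≤ 1 := by nlinarith
  calc _ = 2 * Real.pi * ((1 - turn v) * (b - a)) := by ring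
    _ ≤ 2 * Real.pi * 1 := by gcongr
    _ = _ := mul_one _

/-- A path in the circle from the phase of `v.1` to that of `v.2`. -/
def factor (v : ℂ × ℂ) (t : ℝ) : Circle :=
  phase (if v.1 = 0 then v.2 else v.1) * Circle.exp (lift v t)

/-- `turn` and `centre` depend only on the ratio of the entries, so a scalar enters through its
phase alone. Up to that phase, a linear form is determined by its root. -/
theorem factor_smul {c : ℂ} (hc : c ≠ 0) {v : ℂ × ℂ} (hv : v ≠ 0) (t : ℝ) :
    factor (c • v) t = phase c * factor v t := by
  have h1 : turn (c • v) = turn v := by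
    have h : -((c • v).2 * starRingEnd ℂ (c • v).1) =
        ((‖c‖ ^ 2 : ℝ) : ℂ) * -(v.2 * starRingEnd ℂ v.1) := by
      have := Complex.mul_conj c
      rw [Complex.normSq_eq_norm_sq] at this
      rw [← this]
      simp
      ring
    unfold turn
    rw [h, Complex.arg_real_mul _ (by positivity)]
    simp [hc]
  have h2 : centre (c • v) = centre v := by
    have := norm_pos_iff.2 hc
    have h3 := norm_add_norm_pos hv
    simp only [centre, Prod.smul_fst, Prod.smul_snd, norm_smul]
    rw [← mul_sub, ← mul_add]
    field_simp
  have h3 : (if (c • v).1 = 0 then (c • v).2 else (c • v).1) =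
      c * if v.1 = 0 then v.2 else v.1 := by
    simp only [Prod.smul_fst, Prod.smul_snd, smul_eq_mul, mul_eq_zero, hc, false_or]
    split_ifs <;> rfl
  have h4 : (if v.1 = 0 then v.2 else v.1) ≠ 0 := by
    split_ifs with h
    · exact fun h' => hv (Prod.ext h h')
    · exact h
  rw [factor, h3, phase_mul hc h4, lift, h1, h2, factor, lift, mul_assoc]

theorem factor_of_le_centre {v : ℂ × ℂ} (hv : v.1 ≠ 0) {t : ℝ} (ht : t ≤ centre v) :
    factor v t = phase v.1 := by
  have h : Real.smoothTransition ((t - centre v) / turn v) = 0 :=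
    Real.smoothTransition.zero_of_nonpos
      (div_nonpos_of_nonpos_of_nonneg (by linarith) (turn_pos v).le)
  simp [factor, lift, h, hv]

/-- With `w = v.2 * conj v.1`, the exponent is `arg (-w) - π`, an argument of `w`. -/
theorem phase_mul_exp_turn {v : ℂ × ℂ} (h1 : v.1 ≠ 0) (h2 : v.2 ≠ 0) :
    phase v.1 * Circle.exp (2 * Real.pi * (turn v - 1)) = phase v.2 := by
  have hu : -(v.2 * starRingEnd ℂ v.1) ≠ 0 := by simp [h1, h2]
  have h3 : 2 * Real.pi * (turn v - 1) = (-(v.2 * starRingEnd ℂ v.1)).arg - Real.pi := by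
    have := Real.pi_pos.ne'
    rw [turn, if_neg h1]
    field_simp
    ring
  ext
  rw [h3, Circle.exp_sub, Circle.coe_mul, Circle.coe_div, coe_phase h1, coe_phase h2]
  have h4 := coe_phase hu
  rw [phase] at h4
  rw [h4, Circle.coe_exp, Complex.exp_pi_mul_I, norm_neg, norm_mul, Complex.norm_conj]
  have h5 : v.1 * starRingEnd ℂ v.1 = (‖v.1‖ : ℂ) ^ 2 := by
    rw [Complex.mul_conj, Complex.normSq_eq_norm_sq]; push_cast; rfl
  have n1 : (‖v.1‖ : ℂ) ≠ 0 := by simpa using h1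
  have n2 : (‖v.2‖ : ℂ) ≠ 0 := by simpa using h2
  push_cast
  field_simp
  linear_combination h5

theorem factor_of_turn_le {v : ℂ × ℂ} (hv : v.2 ≠ 0) {t : ℝ} (ht : turn v ≤ t - centre v) :
    factor v t = phase v.2 := by
  have h : Real.smoothTransition ((t - centre v) / turn v) = 1 :=
    Real.smoothTransition.one_of_one_le ((one_le_div (turn_pos v)).2 ht)
  rw [factor, lift, h, mul_one]
  by_cases h1 : v.1 = 0
  · simp [h1, turn]
  · rw [if_neg h1, phase_mul_exp_turn h1 hv]

/-- The jump of `arg` is the only obstacle when `v.1 ≠ 0`; the set `s` allows approaching the cut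
from one side. -/
theorem continuousWithinAt_factor {v : ℂ × ℂ} {s : Set (ℂ × ℂ)} (hv : v.1 ≠ 0)
    (hs : ContinuousWithinAt (fun v : ℂ × ℂ => (-(v.2 * starRingEnd ℂ v.1)).arg) s v) (t : ℝ) :
    ContinuousWithinAt (fun v => factor v t) s v := by
  have hne : ∀ᶠ v' : ℂ × ℂ in 𝓝[s] v, v'.1 ≠ 0 :=
    mem_nhdsWithin_of_mem_nhds (continuous_fst.continuousAt.eventually_ne hv)
  have hturn : ContinuousWithinAt turn s v := by
    have h1 : ContinuousWithinAt (fun v : ℂ × ℂ =>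
        ((-(v.2 * starRingEnd ℂ v.1)).arg + Real.pi) / (2 * Real.pi)) s v :=
      (hs.add continuousWithinAt_const).div_const _
    refine h1.congr_of_eventuallyEq ?_ (if_neg hv)
    filter_upwards [hne] with v' hv' using if_neg hv'
  have hcentre : ContinuousWithinAt centre s v :=
    (continuousAt_centre fun h => hv (by simp [h])).continuousWithinAt
  have hlift : ContinuousWithinAt (fun v => lift v t) s v := by
    unfold lift
    refine (continuousWithinAt_const.mul (hturn.sub continuousWithinAt_const)).mul ?_
    exact Real.smoothTransition.continuousAt.comp_continuousWithinAt
      ((continuousWithinAt_const.sub hcentre).div hturn (turn_pos v).ne')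
  have hphase : ContinuousWithinAt (fun v : ℂ × ℂ => phase v.1) s v :=
    ((continuousAt_phase hv).comp continuous_fst.continuousAt).continuousWithinAt
  have h2 := hphase.mul (Circle.exp.continuous.continuousAt.comp_continuousWithinAt hlift)
  refine h2.congr_of_eventuallyEq ?_ (by simp [factor, hv])
  filter_upwards [hne] with v' hv'
  simp [factor, hv']

/-- Away from the place of the transition, the path depends continuously on its ends. -/
theorem continuousAt_factor {v : ℂ × ℂ} (hv : v ≠ 0) {t : ℝ} (ht : t ∈ Icc (0 : ℝ) 1)
    (htv : t ≠ centre v) : ContinuousAt (fun v => factor v t) v := by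
  have hc := continuousAt_centre hv
  have hsum := norm_add_norm_pos hv
  rcases htv.lt_or_gt with hlt | hgt
  · have h1 : v.1 ≠ 0 := by
      intro h
      -- The range `[-2, 2]` of `centre` exceeds `[0, 1]` so that a vanishing entry pushes the
      -- transition out of sight: at `-2` it is over before time 0, at `2` it has not begun by time
      -- 1.
      have h2 : centre v = -2 := by
        have : v.2 ≠ 0 := fun h' => hv (Prod.ext h h')
        have := norm_pos_iff.2 this
        simp only [centre, h, norm_zero]
        field_simp
        ring
      linarith [ht.1]
    refine (((continuousAt_phase h1).comp continuous_fst.continuousAt)).congr ?_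
    filter_upwards [hc.eventually_const_lt hlt, continuous_fst.continuousAt.eventually_ne h1]
      with v' hv' hv1 using (factor_of_le_centre hv1 hv'.le).symm
  have h2 : v.2 ≠ 0 := by
    intro h
    have h3 : centre v = 2 := by
      have : v.1 ≠ 0 := fun h' => hv (Prod.ext h' h)
      have := norm_pos_iff.2 this
      simp only [centre, h, norm_zero]
      field_simp
      ring
    linarith [ht.2]
  have hsnd : ∀ᶠ v' : ℂ × ℂ in 𝓝 v, v'.2 ≠ 0 := continuous_snd.continuousAt.eventually_ne h2
  have hphase : ContinuousAt (fun v : ℂ × ℂ => phase v.2) v :=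
    (continuousAt_phase h2).comp continuous_snd.continuousAt
  by_cases h1 : v.1 = 0
  · have h3 : centre v < -1 := by
      have := norm_pos_iff.2 h2
      simp only [centre, h1, norm_zero]
      rw [div_lt_iff₀ (by linarith)]
      linarith
    refine hphase.congr ?_
    filter_upwards [hc.eventually_lt_const h3, hsnd] with v' hv' hv2
    exact (factor_of_turn_le hv2 (by linarith [turn_le_one v', ht.1])).symm
  set u : ℂ × ℂ → ℂ := fun v => -(v.2 * starRingEnd ℂ v.1) with hu
  have huc : Continuous u :=
    (continuous_snd.mul (Complex.continuous_conj.comp continuous_fst)).neg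
  by_cases hslit : u v ∈ Complex.slitPlane
  · exact (continuousWithinAt_univ _ _).1 (continuousWithinAt_factor h1
      ((Complex.continuousAt_arg hslit).comp huc.continuousAt).continuousWithinAt t)
  have hu0 : u v ≠ 0 := by simp [hu, h1, h2]
  have him : (u v).im = 0 := by
    by_contra h
    exact hslit (Or.inr h)
  have hre : (u v).re < 0 := by
    refine lt_of_le_of_ne (not_lt.1 fun h => hslit (Or.inl h)) fun h => hu0 (Complex.ext h him)
  have harg : (u v).arg = Real.pi := Complex.arg_eq_pi_iff.2 ⟨hre, him⟩
  -- On the cut the two phases coincide and the path is constant.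
  have hturn : turn v = 1 := by
    have := Real.pi_pos.ne'
    rw [turn, if_neg h1, show (-(v.2 * starRingEnd ℂ v.1)).arg = Real.pi from harg]
    field_simp
    ring
  have hval : factor v t = phase v.2 := by
    rw [← phase_mul_exp_turn h1 h2]
    simp [factor, lift, hturn, h1]
  -- On this side `arg` tends to its value `π`, and the formula for the path is continuous.
  have hA : ContinuousWithinAt (fun v => factor v t) (u ⁻¹' {z | 0 ≤ z.im}) v :=
    continuousWithinAt_factor h1
      ((Complex.continuousWithinAt_arg_of_re_neg_of_im_zero hre him).comp
        huc.continuousWithinAt (mapsTo_preimage _ _)) t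
  -- On the other side `turn` tends to 0: an almost full turn is completed in a vanishing time after
  -- `centre`, hence before `t`. The path already has the phase of the second entry, which is the
  -- limit wanted.
  have hB : ContinuousWithinAt (fun v => factor v t) (u ⁻¹' {z | z.im < 0}) v := by
    have h3 : Tendsto (fun v => (u v).arg) (𝓝[u ⁻¹' {z | z.im < 0}] v) (𝓝 (-Real.pi)) :=
      (Complex.tendsto_arg_nhdsWithin_im_neg_of_re_neg_of_im_zero hre him).comp
        (huc.continuousWithinAt.tendsto_nhdsWithin (mapsTo_preimage _ _))
    have h4 : Tendsto (fun v => ((u v).arg + Real.pi) / (2 * Real.pi))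
        (𝓝[u ⁻¹' {z | z.im < 0}] v) (𝓝 0) := by
      simpa using (h3.add_const Real.pi).div_const (2 * Real.pi)
    have hd : 0 < (t - centre v) / 2 := by linarith
    refine (hphase.continuousWithinAt).congr_of_eventuallyEq ?_ hval
    filter_upwards [h4.eventually_lt_const hd, mem_nhdsWithin_of_mem_nhds hsnd,
      mem_nhdsWithin_of_mem_nhds (continuous_fst.continuousAt.eventually_ne h1),
      mem_nhdsWithin_of_mem_nhds
        (hc.eventually_lt_const (show centre v < (t + centre v) / 2 by linarith))]
      with v' h5 h6 h7 h8
    refine factor_of_turn_le h6 ?_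
    rw [turn, if_neg h7]
    change ((u v').arg + Real.pi) / (2 * Real.pi) ≤ _
    linarith
  have hAB := hA.union hB
  rw [← preimage_union] at hAB
  have huniv : {z : ℂ | 0 ≤ z.im} ∪ {z | z.im < 0} = univ := by
    ext z; simpa using le_or_gt 0 z.im
  rw [huniv, preimage_univ] at hAB
  exact (continuousWithinAt_univ _ _).1 hAB

/-! ### Products of transitions and their continuity in `L¹` -/

namespace SmoothMap

/-- The smooth map with angle function `θ`. -/
def ofAngle (c : Circle) (θ : ℝ → ℝ) (hθ : ContDiff ℝ ∞ θ) : SmoothMap where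
  toFun t := c * Circle.exp (θ t)
  smooth := by
    have h : ContDiff ℝ ∞ fun x : ℝ => (c : ℂ) * Complex.exp (θ x * Complex.I) :=
      contDiff_const.mul ((Complex.ofRealCLM.contDiff.comp hθ).mul contDiff_const).cexp
    refine h.contDiffOn.congr fun x hx => ?_
    rw [IccExtend_of_mem _ _ hx]
    simp

/-- The speed is `|θ'| = -θ'`, whose integral is the total drop of the angle. -/
theorem w11Norm_ofAngle (c : Circle) {θ : ℝ → ℝ} (hθ : ContDiff ℝ ∞ θ) (hanti : Antitone θ) :
    (ofAngle c θ hθ).w11Norm = 1 + (θ 0 - θ 1) := by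
  have hd : ∀ x, HasDerivAt θ (deriv θ x) x := fun x =>
    (hθ.differentiable (by simp) x).hasDerivAt
  have h1 : ∀ x ∈ Icc (0 : ℝ) 1, ‖(ofAngle c θ hθ).dfn x‖ = -deriv θ x := by
    intro x hx
    have h2 : HasDerivAt (fun x : ℝ => (c : ℂ) * Complex.exp (θ x * Complex.I))
        (c * (Complex.exp (θ x * Complex.I) * (deriv θ x * Complex.I))) x :=
      (((hd x).ofReal_comp.mul_const Complex.I).cexp).const_mul _
    have h3 : ∀ y ∈ Icc (0 : ℝ) 1,
        (ofAngle c θ hθ).fn y = (c : ℂ) * Complex.exp (θ y * Complex.I) := by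
      intro y hy
      rw [fn, IccExtend_of_mem _ _ hy]
      simp [ofAngle]
    have h4 := h2.hasDerivWithinAt.congr h3 (h3 x hx)
    rw [dfn, h4.derivWithin (uniqueDiffOn_Icc zero_lt_one x hx)]
    simp only [norm_mul, Circle.norm_coe, Complex.norm_exp_ofReal_mul_I, Complex.norm_real,
      Complex.norm_I, one_mul, mul_one, Real.norm_eq_abs]
    exact abs_of_nonpos hanti.deriv_nonpos
  rw [w11Norm_eq, intervalIntegral.integral_congr (g := fun x => -deriv θ x) fun x hx =>
    h1 x (by rwa [uIcc_of_le zero_le_one] at hx), intervalIntegral.integral_neg,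
    intervalIntegral.integral_eq_sub_of_hasDerivAt (fun x _ => hd x)
      ((hθ.continuous_deriv (by simp)).intervalIntegrable _ _)]
  ring

/-- The product of the transitions given by the pairs `V j`. -/
def prodMap {k : ℕ} (u : Circle) (V : Fin k → ℂ × ℂ) : SmoothMap :=
  ofAngle (u * ∏ j, phase (if (V j).1 = 0 then (V j).2 else (V j).1)) (fun t => ∑ j, lift (V j) t)
    (ContDiff.sum fun j _ => contDiff_lift (V j))

theorem prodMap_toFun {k : ℕ} (u : Circle) (V : Fin k → ℂ × ℂ) (t : Icc (0 : ℝ) 1) :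
    (prodMap u V).toFun t = u * ∏ j, factor (V j) t := by
  have h : Circle.exp (∑ j, lift (V j) t) = ∏ j, Circle.exp (lift (V j) t) := by
    induction (Finset.univ : Finset (Fin k)) using Finset.induction with
    | empty => simp
    | insert j s hj ih => rw [Finset.sum_insert hj, Finset.prod_insert hj, Circle.exp_add, ih]
  simp only [prodMap, ofAngle, factor, Finset.prod_mul_distrib, mul_assoc, h]

theorem w11Norm_prodMap_le {k : ℕ} (u : Circle) (V : Fin k → ℂ × ℂ) :
    (prodMap u V).w11Norm ≤ 1 + Real.pi * (2 * k : ℕ) := by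
  rw [prodMap, w11Norm_ofAngle]
  · have h : ∑ j, lift (V j) 0 - ∑ j, lift (V j) 1 ≤ ∑ _j : Fin k, 2 * Real.pi := by
      rw [← Finset.sum_sub_distrib]
      exact Finset.sum_le_sum fun j _ => lift_sub_lift_le _ _ _
    simp only [Finset.sum_const, Finset.card_univ, Fintype.card_fin, nsmul_eq_mul] at h
    push_cast
    linarith
  · exact fun s t hst => Finset.sum_le_sum fun j _ => antitone_lift (V j) hst

/-- Dominated convergence: for all `t` except the finitely many centres the values converge, and the
integrand is at most 2. -/
theorem continuousAt_prodMap {X : Type*} [TopologicalSpace X] [FirstCountableTopology X] {k : ℕ}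
    {u : X → Circle} {V : X → Fin k → ℂ × ℂ} (hu : Continuous u) (hV : Continuous V) {x : X}
    (hx : ∀ j, V x j ≠ 0) : ContinuousAt (fun x => prodMap (u x) (V x)) x := by
  refine tendsto_iff_dist_tendsto_zero.2 ?_
  simp only [dist_def]
  have hcont : ∀ y, ContinuousOn (fun t => ‖(prodMap (u y) (V y)).fn t - (prodMap (u x) (V x)).fn t‖)
      (uIcc 0 1) := fun y => by
    rw [uIcc_of_le zero_le_one]
    exact continuousOn_norm_sub _ _
  have key := intervalIntegral.tendsto_integral_filter_of_dominated_convergence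
    (μ := MeasureTheory.volume) (a := 0) (b := 1) (l := 𝓝 x)
    (F := fun y t => ‖(prodMap (u y) (V y)).fn t - (prodMap (u x) (V x)).fn t‖)
    (f := fun _ => (0 : ℝ)) (fun _ => 2) ?_ ?_ ?_ ?_
  · simpa using key
  · refine Eventually.of_forall fun y => ?_
    exact ((hcont y).mono uIoc_subset_uIcc).aestronglyMeasurable measurableSet_uIoc
  · refine Eventually.of_forall fun y => Eventually.of_forall fun t _ => ?_
    rw [norm_norm]
    refine (norm_sub_le _ _).trans ?_
    rw [norm_fn, norm_fn]
    norm_num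
  · simp
  · have hfin : (range fun j => centre (V x j)).Finite := finite_range _
    have hae := MeasureTheory.measure_eq_zero_iff_ae_notMem.1
      (hfin.measure_zero MeasureTheory.volume)
    filter_upwards [hae] with t ht hmem
    have ht01 : t ∈ Icc (0 : ℝ) 1 := by
      rw [uIoc_of_le zero_le_one] at hmem
      exact Ioc_subset_Icc_self hmem
    have hfn : ∀ y, (prodMap (u y) (V y)).fn t =
        ((u y * ∏ j, factor (V y j) t : Circle) : ℂ) := fun y => by
      rw [← prodMap_toFun (u y) (V y) ⟨t, ht01⟩, ← fn_coe]
    simp only [hfn]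
    rw [← tendsto_iff_norm_sub_tendsto_zero]
    refine (continuous_subtype_val.tendsto _).comp ?_
    refine hu.continuousAt.tendsto.mul (tendsto_finsetProd _ fun j _ => ?_)
    exact (continuousAt_factor (hx j) ht01 fun h => ht ⟨j, h.symm⟩).tendsto.comp
      ((continuous_apply j).comp hV).continuousAt

end SmoothMap

end CircleMaps

/-! ### Polynomials and their linear factors -/

namespace CircleMaps

open Polynomial

/-- The polynomial `v.1 X + v.2`. -/
def lin (v : ℂ × ℂ) : ℂ[X] := C v.1 * X + C v.2

theorem lin_ne_zero {v : ℂ × ℂ} (hv : v ≠ 0) : lin v ≠ 0 := by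
  intro h
  refine hv (Prod.ext ?_ ?_)
  · simpa [lin] using congrArg (fun p => p.coeff 1) h
  · simpa [lin] using congrArg (fun p => p.coeff 0) h

/-- The product of the transitions given by the roots of a polynomial of degree at most `k`, the
missing roots being at infinity. -/
def rootProd (k : ℕ) (p : ℂ[X]) (t : ℝ) : Circle :=
  phase p.leadingCoeff * (p.roots.map fun w => factor (1, -w) t).prod *
    factor (0, 1) t ^ (k - p.natDegree)

/-- A form with `v.1 ≠ 0` contributes the root `-v.2 / v.1` and its leading coefficient; one with
`v.1 = 0` contributes a root at infinity and a constant. -/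
theorem rootProd_lin_mul {k : ℕ} {v : ℂ × ℂ} (hv : v ≠ 0) {p : ℂ[X]} (hp : p ≠ 0)
    (hk : p.natDegree ≤ k) (t : ℝ) :
    rootProd (k + 1) (lin v * p) t = factor v t * rootProd k p t := by
  have hlc : p.leadingCoeff ≠ 0 := leadingCoeff_ne_zero.2 hp
  by_cases h1 : v.1 = 0
  · have h2 : v.2 ≠ 0 := fun h => hv (Prod.ext h1 h)
    have h3 : lin v = C v.2 := by simp [lin, h1]
    have h4 : factor v t = phase v.2 * factor (0, 1) t := by
      rw [← factor_smul h2 (by simp)]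
      congr 1
      ext <;> simp [h1]
    rw [rootProd, rootProd, h3, leadingCoeff_mul, leadingCoeff_C, roots_C_mul _ h2,
      natDegree_C_mul h2, h4, phase_mul h2 hlc, Nat.succ_sub hk, pow_succ]
    ac_rfl
  · have h3 : lin v = C v.1 * (X - C (-(v.2 / v.1))) := by
      rw [lin, map_neg, sub_neg_eq_add, mul_add, ← C_mul, mul_div_cancel₀ _ h1]
    have h4 : factor v t = phase v.1 * factor (1, -(-(v.2 / v.1))) t := by
      rw [← factor_smul h1 (by simp)]
      congr 1
      ext
      · simp
      · simp [mul_div_cancel₀ _ h1]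
    have hX := X_sub_C_ne_zero (-(v.2 / v.1))
    rw [rootProd, rootProd, h3, mul_assoc (C v.1), leadingCoeff_mul, leadingCoeff_C, leadingCoeff_mul,
      leadingCoeff_X_sub_C, one_mul, roots_C_mul _ h1, roots_mul (mul_ne_zero hX hp),
      roots_X_sub_C, Multiset.map_add, Multiset.prod_add, Multiset.map_singleton,
      Multiset.prod_singleton, natDegree_C_mul h1, natDegree_mul hX hp, natDegree_X_sub_C, h4,
      phase_mul h1 hlc, add_comm 1 p.natDegree, Nat.add_sub_add_right]
    ac_rfl

theorem rootProd_real_mul (k : ℕ) {r : ℝ} (hr : 0 < r) (p : ℂ[X]) (t : ℝ) :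
    rootProd k (C (r : ℂ) * p) t = rootProd k p t := by
  have hr0 : (r : ℂ) ≠ 0 := by exact_mod_cast hr.ne'
  rw [rootProd, rootProd, leadingCoeff_mul, leadingCoeff_C, roots_C_mul _ hr0, natDegree_C_mul hr0,
    phase_real_mul hr]

/-- The polynomial with the leading factor `c` and the linear factors given by `V`. -/
def polyOf {k : ℕ} (c : ℂ) (V : Fin k → ℂ × ℂ) : ℂ[X] := C c * ∏ j, lin (V j)

theorem polyOf_cons {k : ℕ} (c : ℂ) (v : ℂ × ℂ) (V : Fin k → ℂ × ℂ) :
    polyOf c (Fin.cons v V : Fin (k + 1) → ℂ × ℂ) = lin v * polyOf c V := by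
  simp only [polyOf, Fin.prod_univ_succ, Fin.cons_zero, Fin.cons_succ]
  ring

theorem polyOf_succ {k : ℕ} (c : ℂ) (V : Fin (k + 1) → ℂ × ℂ) :
    polyOf c V = lin (V 0) * polyOf c fun j => V j.succ := by
  simp only [polyOf, Fin.prod_univ_succ]
  ring

theorem polyOf_ne_zero {k : ℕ} {c : ℂ} (hc : c ≠ 0) {V : Fin k → ℂ × ℂ} (hV : ∀ j, V j ≠ 0) :
    polyOf c V ≠ 0 :=
  mul_ne_zero (C_ne_zero.2 hc) (Finset.prod_ne_zero_iff.2 fun j _ => lin_ne_zero (hV j))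

theorem natDegree_polyOf_le {k : ℕ} (c : ℂ) (V : Fin k → ℂ × ℂ) :
    (polyOf c V).natDegree ≤ k := by
  refine (natDegree_C_mul_le _ _).trans ((natDegree_prod_le _ _).trans ?_)
  calc _ ≤ ∑ _j : Fin k, 1 := Finset.sum_le_sum fun j _ => natDegree_linear_le
    _ = k := by simp

/-- The right side uses a factorization, the left side only the polynomial: different factorizations
give the same circle map. -/
theorem rootProd_polyOf {k : ℕ} {c : ℂ} (hc : c ≠ 0) {V : Fin k → ℂ × ℂ} (hV : ∀ j, V j ≠ 0)
    (t : ℝ) : rootProd k (polyOf c V) t = phase c * ∏ j, factor (V j) t := by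
  induction k with
  | zero => simp [polyOf, rootProd]
  | succ k ih =>
    rw [polyOf_succ, rootProd_lin_mul (hV 0) (polyOf_ne_zero hc fun j => hV j.succ)
      (natDegree_polyOf_le _ _), ih fun j => hV j.succ, Fin.prod_univ_succ]
    ac_rfl

theorem exists_polyOf {k : ℕ} {p : ℂ[X]} (hp : p ≠ 0) (hk : p.natDegree ≤ k) :
    ∃ c ≠ 0, ∃ V : Fin k → ℂ × ℂ, (∀ j, ‖V j‖ = 1) ∧ p = polyOf c V := by
  induction k generalizing p with
  | zero =>
    have h := eq_C_of_natDegree_le_zero hk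
    refine ⟨p.coeff 0, fun h0 => hp (by rw [h, h0, C_0]), fun _ => 0, fun j => j.elim0, ?_⟩
    simpa [polyOf] using h
  | succ k ih =>
    rcases hk.lt_or_eq with hlt | heq
    · obtain ⟨c, hc, V, hV, rfl⟩ := ih hp (Nat.lt_succ_iff.1 hlt)
      -- A missing degree is filled by the constant form 1, with root at infinity.
      refine ⟨c, hc, Fin.cons (0, 1) V, Fin.cases (by simp [Prod.norm_def]) (by simpa using hV), ?_⟩
      rw [polyOf_cons]
      simp [lin]
    · obtain ⟨w, hw⟩ := IsAlgClosed.exists_root p fun h => by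
        rw [natDegree_eq_zero_iff_degree_le_zero.2 h.le] at heq
        omega
      obtain ⟨q, rfl⟩ := dvd_iff_isRoot.2 hw
      have hq : q ≠ 0 := right_ne_zero_of_mul hp
      have hqk : q.natDegree ≤ k := by
        rw [natDegree_mul (X_sub_C_ne_zero w) hq, natDegree_X_sub_C] at hk
        omega
      obtain ⟨c, hc, V, hV, rfl⟩ := ih hq hqk
      set v : ℂ × ℂ := (1, -w) with hv
      have hv0 : v ≠ 0 := by simp [hv]
      have hn : ‖v‖ ≠ 0 := norm_ne_zero_iff.2 hv0
      have hn' : (‖v‖ : ℂ) ≠ 0 := by exact_mod_cast hn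
      refine ⟨‖v‖ * c, mul_ne_zero hn' hc, Fin.cons (‖v‖⁻¹ • v) V,
        Fin.cases (by simp [norm_smul, hn]) (by simpa using hV), ?_⟩
      have h1 : lin (‖v‖⁻¹ • v) = C ((‖v‖ : ℂ)⁻¹) * (X - C w) := by
        simp [lin, hv, sub_eq_add_neg, mul_add]
      have h2 : polyOf (‖v‖ * c) V = C (‖v‖ : ℂ) * polyOf c V := by
        simp only [polyOf, C_mul, mul_assoc]
      rw [polyOf_cons, h1, h2]
      have h3 : C ((‖v‖ : ℂ)⁻¹) * C (‖v‖ : ℂ) = 1 := by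
        rw [← C_mul, inv_mul_cancel₀ hn', C_1]
      linear_combination (-(X - C w) * polyOf c V) * h3

theorem continuous_coeff_polyOf {X : Type*} [TopologicalSpace X] {k : ℕ} {c : X → ℂ}
    {V : X → Fin k → ℂ × ℂ} (hc : Continuous c) (hV : Continuous V) (i : ℕ) :
    Continuous fun x => (polyOf (c x) (V x)).coeff i := by
  induction k generalizing i with
  | zero =>
    simp only [polyOf, Finset.univ_eq_empty, Finset.prod_empty, mul_one, coeff_C]
    split_ifs
    exacts [hc, continuous_const]
  | succ k ih =>
    have h0 : Continuous fun x => V x 0 := (continuous_apply 0).comp hV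
    have h := fun i => ih (V := fun x j => V x j.succ)
      (continuous_pi fun j => (continuous_apply j.succ).comp hV) i
    simp only [polyOf_succ, lin, add_mul, mul_assoc, coeff_add, coeff_C_mul]
    refine Continuous.add ((continuous_fst.comp h0).mul ?_) ((continuous_snd.comp h0).mul (h i))
    cases i with
    | zero => simpa using continuous_const
    | succ i => simpa only [coeff_X_mul] using h i

/-! ### Descent from factorizations to the sphere of polynomials -/

/-- The vectors of coefficients of norm one of polynomials of degree at most `k`. -/
abbrev CoeffSphere (k : ℕ) : Type := Metric.sphere (0 : Fin (k + 1) → ℂ) 1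

/-- A phase and `k` linear polynomials of norm one. -/
abbrev Factors (k : ℕ) : Type := Circle × (Fin k → Metric.sphere (0 : ℂ × ℂ) 1)

namespace Factors

variable {k : ℕ}

/-- The linear polynomials as vectors. -/
def vec (a : Factors k) (j : Fin k) : ℂ × ℂ := a.2 j

theorem vec_ne_zero (a : Factors k) (j : Fin k) : a.vec j ≠ 0 :=
  Metric.ne_of_mem_sphere (a.2 j).2 one_ne_zero

theorem continuous_vec : Continuous (vec (k := k)) :=
  continuous_pi fun j => continuous_subtype_val.comp ((continuous_apply j).comp continuous_snd)

/-- The product polynomial. -/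
def poly (a : Factors k) : ℂ[X] := polyOf a.1 a.vec

/-- The coefficients of the product polynomial. -/
def coeffs (a : Factors k) (i : Fin (k + 1)) : ℂ := a.poly.coeff i

theorem poly_ext {p q : ℂ[X]} (hp : p.natDegree ≤ k) (hq : q.natDegree ≤ k)
    (h : ∀ i : Fin (k + 1), p.coeff i = q.coeff i) : p = q := by
  ext i
  by_cases hi : i < k + 1
  · exact h ⟨i, hi⟩
  · rw [coeff_eq_zero_of_natDegree_lt (by omega), coeff_eq_zero_of_natDegree_lt (by omega)]

theorem coeffs_ne_zero (a : Factors k) : a.coeffs ≠ 0 := fun h =>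
  polyOf_ne_zero (Circle.coe_ne_zero a.1) a.vec_ne_zero <|
    poly_ext (natDegree_polyOf_le _ _) (by simp) fun i => (congrFun h i).trans (coeff_zero _).symm

theorem continuous_coeffs : Continuous (coeffs (k := k)) :=
  continuous_pi fun i => continuous_coeff_polyOf
    (continuous_subtype_val.comp continuous_fst) continuous_vec i

theorem normalize_coeffs_mem_sphere (a : Factors k) : ‖a.coeffs‖⁻¹ • a.coeffs ∈
    Metric.sphere (0 : Fin (k + 1) → ℂ) 1 := by
  simp [norm_smul, a.coeffs_ne_zero]

theorem continuous_normalize_coeffs :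
    Continuous fun a : Factors k => ‖a.coeffs‖⁻¹ • a.coeffs :=
  (continuous_coeffs.norm.inv₀ fun a => norm_ne_zero_iff.2 a.coeffs_ne_zero).smul
    continuous_coeffs

/-- The normalized coefficients of the product polynomial. -/
def toSphere : C(Factors k, CoeffSphere k) where
  toFun a := ⟨‖a.coeffs‖⁻¹ • a.coeffs, a.normalize_coeffs_mem_sphere⟩
  continuous_toFun := continuous_normalize_coeffs.subtype_mk _

theorem surjective_toSphere : Function.Surjective (toSphere (k := k)) := by
  intro x
  set p : ℂ[X] := ∑ i : Fin (k + 1), C (x.1 i) * X ^ (i : ℕ) with hp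
  have hcoeff : ∀ i : Fin (k + 1), p.coeff i = x.1 i := by
    intro i
    simp [hp, finsetSum_coeff, coeff_X_pow, Fin.val_inj]
  have hdeg : p.natDegree ≤ k :=
    natDegree_sum_le_of_forall_le _ _ fun i _ => (natDegree_C_mul_X_pow_le _ _).trans (by omega)
  have hx0 : x.1 ≠ 0 := Metric.ne_of_mem_sphere x.2 one_ne_zero
  have hp0 : p ≠ 0 := fun h => hx0 (funext fun i => by rw [← hcoeff, h]; rfl)
  obtain ⟨c, hc, V, hV, hpV⟩ := exists_polyOf hp0 hdeg
  have hn : (‖c‖ : ℂ) ≠ 0 := by simpa using hc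
  set a : Factors k := (phase c, fun j => ⟨V j, by simpa using hV j⟩) with ha
  have h1 : a.poly = C ((‖c‖ : ℂ)⁻¹) * p := by
    rw [hpV, poly, polyOf, polyOf, ← mul_assoc, ← C_mul]
    congr 2
    rw [coe_phase hc]
    field_simp
  have h2 : a.coeffs = ‖c‖⁻¹ • x.1 := by
    funext i
    simp [coeffs, h1, hcoeff]
  have h3 : ‖x.1‖ = 1 := mem_sphere_zero_iff_norm.1 x.2
  have h4 : ‖c‖ ≠ 0 := norm_ne_zero_iff.2 hc
  refine ⟨a, Subtype.ext ?_⟩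
  change ‖a.coeffs‖⁻¹ • a.coeffs = x.1
  rw [h2, norm_smul, h3, smul_smul]
  simp [h4]

/-- A continuous surjection from a compact space to a Hausdorff one. It replaces any continuous
choice of roots. -/
theorem isQuotientMap_toSphere : Topology.IsQuotientMap (toSphere (k := k)) :=
  toSphere.continuous.isClosedMap.isQuotientMap toSphere.continuous surjective_toSphere

theorem eq_smul_of_normalize_eq {E : Type*} [NormedAddCommGroup E] [NormedSpace ℝ E] {x y : E}
    (hx : x ≠ 0) (h : ‖x‖⁻¹ • x = ‖y‖⁻¹ • y) : x = (‖x‖ * ‖y‖⁻¹) • y := by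
  rw [mul_smul, ← h, smul_smul, mul_inv_cancel₀ (norm_ne_zero_iff.2 hx), one_smul]

theorem poly_eq_of_toSphere_eq {a b : Factors k} (h : toSphere a = toSphere b) :
    ∃ r : ℝ, 0 < r ∧ a.poly = C (r : ℂ) * b.poly := by
  have ha := norm_pos_iff.2 a.coeffs_ne_zero
  have hb := norm_pos_iff.2 b.coeffs_ne_zero
  have h1 : ‖a.coeffs‖⁻¹ • a.coeffs = ‖b.coeffs‖⁻¹ • b.coeffs := congrArg Subtype.val h
  have h2 : a.coeffs = (‖a.coeffs‖ * ‖b.coeffs‖⁻¹) • b.coeffs :=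
    eq_smul_of_normalize_eq a.coeffs_ne_zero h1
  refine ⟨‖a.coeffs‖ * ‖b.coeffs‖⁻¹, mul_pos ha (inv_pos.2 hb), ?_⟩
  refine poly_ext (natDegree_polyOf_le _ _)
    ((natDegree_C_mul_le _ _).trans (natDegree_polyOf_le _ _)) fun i => ?_
  rw [coeff_C_mul]
  simpa [coeffs] using congrFun h2 i

/-- The circle-valued map given by a family of factors. -/
def toY {n : ℕ} (hk : 2 * k ≤ n) : C(Factors k, Y n) where
  toFun a := ⟨SmoothMap.prodMap a.1 a.vec, (SmoothMap.w11Norm_prodMap_le _ _).trans (by gcongr)⟩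
  continuous_toFun := Continuous.subtype_mk (continuous_iff_continuousAt.2 fun a : Factors k =>
    SmoothMap.continuousAt_prodMap continuous_fst continuous_vec a.vec_ne_zero) _

/-- Equal normalized coefficients mean polynomials that differ by a positive real factor, which
`rootProd` ignores. -/
theorem factorsThrough_toY {n : ℕ} (hk : 2 * k ≤ n) :
    Function.FactorsThrough (toY hk) (toSphere (k := k)) := by
  intro a b h
  obtain ⟨r, hr, hab⟩ := poly_eq_of_toSphere_eq h
  refine Subtype.ext (SmoothMap.ext fun t => ?_)
  have key : ∀ a : Factors k, (toY hk a).1.toFun t = rootProd k a.poly t := fun a => by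
    rw [poly, rootProd_polyOf (Circle.coe_ne_zero a.1) a.vec_ne_zero, phase_coe]
    exact SmoothMap.prodMap_toFun _ _ _
  rw [key, key, hab, rootProd_real_mul k hr]

end Factors

/-- The map from the sphere of polynomials of degree at most `k` to the space of circle-valued
maps. -/
def sphereToY {k n : ℕ} (hk : 2 * k ≤ n) : C(CoeffSphere k, Y n) :=
  Factors.isQuotientMap_toSphere.lift (Factors.toY hk) (Factors.factorsThrough_toY hk)

/-- The sign of the polynomial can be absorbed into the phase `u`, which multiplies the circle map
pointwise. -/
theorem sphereToY_neg {k n : ℕ} (hk : 2 * k ≤ n) (x : CoeffSphere k) :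
    sphereToY hk (-x) = Y.neg (sphereToY hk x) := by
  obtain ⟨⟨u, V⟩, rfl⟩ := Factors.surjective_toSphere x
  have hl : ∀ a, sphereToY hk (Factors.toSphere a) = Factors.toY hk a := fun a =>
    DFunLike.congr_fun
      (Factors.isQuotientMap_toSphere.lift_comp _ (Factors.factorsThrough_toY hk)) a
  have h1 : -Factors.toSphere (u, V) = Factors.toSphere (-u, V) := by
    have h2 : Factors.coeffs (-u, V) = -Factors.coeffs (u, V) := by
      funext i
      simp [Factors.coeffs, Factors.poly, polyOf, Factors.vec]
    refine Subtype.ext ?_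
    change -(‖Factors.coeffs (u, V)‖⁻¹ • Factors.coeffs (u, V)) =
      ‖Factors.coeffs (-u, V)‖⁻¹ • Factors.coeffs (-u, V)
    rw [h2, norm_neg, smul_neg]
  rw [h1, hl, hl]
  refine Subtype.ext (SmoothMap.ext fun t => ?_)
  change (SmoothMap.prodMap (-u) _).toFun t = -(SmoothMap.prodMap u _).toFun t
  rw [SmoothMap.prodMap_toFun, SmoothMap.prodMap_toFun, neg_mul]
  rfl

/-! ### The odd map on `S^n` -/

/-- Consecutive pairs of real coordinates as complex coordinates. -/
def pairing {n : ℕ} (k : ℕ) (x : EuclideanSpace ℝ (Fin (n + 1))) (i : Fin (k + 1)) : ℂ :=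
  ⟨if h : 2 * (i : ℕ) < n + 1 then x ⟨2 * i, h⟩ else 0,
    if h : 2 * (i : ℕ) + 1 < n + 1 then x ⟨2 * i + 1, h⟩ else 0⟩

theorem continuous_pairing (n k : ℕ) : Continuous (pairing (n := n) k) := by
  refine continuous_pi fun i => ?_
  have h : ∀ a b : EuclideanSpace ℝ (Fin (n + 1)) → ℝ, Continuous a → Continuous b →
      Continuous fun x => (⟨a x, b x⟩ : ℂ) := fun a b ha hb =>
    Complex.equivRealProdCLM.symm.continuous.comp (ha.prodMk hb)
  refine h _ _ ?_ ?_ <;> split_ifs <;> fun_prop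

theorem pairing_neg {n : ℕ} (k : ℕ) (x : EuclideanSpace ℝ (Fin (n + 1))) :
    pairing k (-x) = -pairing k x := by
  funext i
  apply Complex.ext <;> simp only [pairing, Pi.neg_apply, Complex.neg_re, Complex.neg_im] <;>
    split_ifs <;> simp

theorem pairing_ne_zero {n k : ℕ} (hk : n ≤ 2 * k + 1) {x : EuclideanSpace ℝ (Fin (n + 1))}
    (hx : x ≠ 0) : pairing k x ≠ 0 := by
  intro h
  refine hx (PiLp.ext fun j => ?_)
  have hj : (j : ℕ) / 2 < k + 1 := by omega
  have h1 := congrFun h ⟨j / 2, hj⟩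
  rcases Nat.mod_two_eq_zero_or_one j with h2 | h2
  · have h3 := congrArg Complex.re h1
    have h4 : 2 * ((j : ℕ) / 2) = j := by omega
    simpa [pairing, h4, Nat.lt_succ_iff.1 j.2] using h3
  · have h3 := congrArg Complex.im h1
    have h4 : 2 * ((j : ℕ) / 2) + 1 = j := by omega
    simpa [pairing, h4, Nat.lt_succ_iff.1 j.2] using h3

/-- Consecutive pairs of real coordinates as complex coordinates, normalized. -/
def pairingSphere {n k : ℕ} (hk : n ≤ 2 * k + 1) : C(UnitSphere n, CoeffSphere k) where
  toFun x := ⟨‖pairing k x.1‖⁻¹ • pairing k x.1, by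
    simp [norm_smul, pairing_ne_zero hk (Metric.ne_of_mem_sphere x.2 one_ne_zero)]⟩
  continuous_toFun := by
    have h := (continuous_pairing n k).comp (continuous_subtype_val (p := (· ∈ Metric.sphere 0 1)))
    exact Continuous.subtype_mk ((h.norm.inv₀ fun x => norm_ne_zero_iff.2
      (pairing_ne_zero hk (Metric.ne_of_mem_sphere x.2 one_ne_zero))).smul h) _

theorem exists_odd_map (n : ℕ) : ∃ f : C(UnitSphere n, Y n), ∀ x, f (-x) = Y.neg (f x) := by
  -- With `k = n / 2`, the first inequality keeps the variation `2πk` within `πn`; the second makes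
  -- `k + 1` complex coordinates enough for `n + 1` real ones.
  have h1 : 2 * (n / 2) ≤ n := by omega
  have h2 : n ≤ 2 * (n / 2) + 1 := by omega
  refine ⟨(sphereToY h1).comp (pairingSphere h2), fun x => ?_⟩
  have h3 : pairingSphere h2 (-x) = -pairingSphere h2 x := by
    refine Subtype.ext ?_
    change ‖pairing (n / 2) (-x.1)‖⁻¹ • pairing (n / 2) (-x.1) =
      -(‖pairing (n / 2) x.1‖⁻¹ • pairing (n / 2) x.1)
    rw [pairing_neg, norm_neg, smul_neg]
  rw [ContinuousMap.comp_apply, h3, sphereToY_neg, ContinuousMap.comp_apply]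

end CircleMaps

/-- The coindex of `Y_n` exists and lies between `n` and `2n - 1`. -/
theorem theorem6p2 (n : ℕ) (hn : 1 ≤ n) :
    ∃ k : ℕ, IsCoindex (CircleMaps.Y.neg (n := n)) k ∧ n ≤ k ∧ (k : ℤ) ≤ 2 * (n : ℤ) - 1 := by
  set S := {m : ℕ | ∃ f : C(UnitSphere m, CircleMaps.Y n), ∀ x, f (-x) = CircleMaps.Y.neg (f x)}
    with hS
  have hmem : n ∈ S := CircleMaps.exists_odd_map n
  have hlt : ∀ m ∈ S, m < 2 * n := fun m ⟨f, hf⟩ => CircleMaps.lt_of_odd_map hn f hf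
  have hbdd : BddAbove S := ⟨2 * n, fun m hm => (hlt m hm).le⟩
  have hsup := Nat.sSup_mem ⟨n, hmem⟩ hbdd
  refine ⟨sSup S, ⟨hsup, fun m hm => le_csSup hbdd hm⟩, le_csSup hbdd hmem, ?_⟩
  have := hlt _ hsup
  omega

end
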